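/- Let $\sigma>0$, $\mu\neq 0$, $r\in\mathbb R$, $\theta\ge 0$, $\lambda_B,\lambda_C\ge 0$, $T>0$, $K>0$, $\delta\in\{0,1,-1\}$, and let $C_T(s)=(s-K)^+$ (call) or $C_T(s)=(K-s)^+$ (put). Let $U:\mathbb R\to\mathbb R$ be a $C^2$ utility function with $U'>0$ and constant risk aversion $R=-U''/U'\equiv\gamma\ge 0$ (exponential if $\gamma>0$, linear if $\gamma=0$). Put $[x]^-=\min(x,0)$, $w=\beta+s(\alpha-\theta|\alpha|)$, and $$\mathcal V_A=\partial_t+\tfrac{\sigma^2}{2}s^2\partial_s^2+\mu s\partial_s+r\beta\partial_\beta,\quad \mathcal V_B=-\partial_\alpha+s(1+\theta)\partial_\beta,\quad \mathcal V_C=\partial_\alpha-s(1-\theta)\partial_\beta,$$ so that $\mathcal V_B(w)=2s\theta$, $\mathcal V_C(w)=0$ for $\alpha>0$ and $\mathcal V_B(w)=0$, $\mathcal V_C(w)=2s\theta$ for $\alpha\le 0$ (left derivative at $\alpha=0$). For a function $\mathscr V(\alpha,\beta,s,t)$ let $z=e^{\mu(T-t)}\bigl(w+\tfrac{\beta}{\mu}(r-\mu)(1-e^{-\mu(T-t)})+\mathscr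 V\bigr)$, and consider the transformed penalized equation $$\mathcal V_A(\mathscr V)-\mu\mathscr V-\tfrac{\sigma^2}{2}R(z)e^{\mu(T-t)}(s\partial_s w+s\partial_s\mathscr V)^2+\lambda_B[\mathcal V_B(w)+\mathcal V_B(\mathscr V)]^-+\lambda_C[\mathcal V_C(w)+\mathcal V_C(\mathscr V)]^-=0,$$ with $\mathscr V(\alpha,\beta,s,T)=\delta C_T(s)$, for $(\alpha,s)\in D$, $\beta\in\mathbb R$, $t\in[0,T]$. Here $D$ is the whole region $\mathbb R\times(0,\infty)$ or, more generally, it may be a bounded open set whose closure lies in $\mathbb R\times(0,\infty)$. A solution is a function that is continuous up to $t=0$, $t=T$ and up to the part of $\partial D$ in $s>0$, is differentiable in $(\alpha,\beta,s,t)$ and twice differentiable in $s$ for $(\alpha,s)\in D$, $0<t<T$, satisfies the equation there and the terminal condition, and is bounded by $C(1+|\alpha|+|\beta|+s+1/s)^k$ for some $C,k$. If $D$ is bounded, the values of a solution at $(\alpha,s)\in\partial D$ are required not to depend on $\beta$ (if $D=\mathbb R\times(0,\infty)$ there is no such requirement). Then every solution $\mathscr V$ is independent of $\beta$: $\mathscr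 V=\mathscr V(\alpha,s,t)$ for $(\alpha,s)\in D$, $t\in[0,T]$. Consequently, if $\mathscr V^0$ is a solution for $\delta=0$, then the option price $V=e^{-r(T-t)}(z^\delta-z^0)$ is independent of $\beta$, where $z^\delta=w-U^{-1}(v^\delta)$, $z^0=w-U^{-1}(v^0)$ are the certainty equivalents and $v^\delta=U(z)$, $v^0=U(z)$ with $z$ formed from $\mathscr V$ and from $\mathscr V^0$, respectively. Moreover, let $\mathscr V_{BS}(s,t)$ be the Black–Scholes solution, that is, the classical solution of $$\partial_t u+\tfrac{\sigma^2}{2}s^2\partial_s^2u+\mu s\partial_su-\mu u=0\quad(s>0,\ 0<t<T),\qquad u(s,T)=\delta C_T(s),$$ continuous up to $t=0,T$ and bounded by $C(1+s+1/s)^k$ for some $C,k$. Then $$\mathscr V(\alpha,s,t)\le\mathscr V_{BS}(s,t)\quad\text{for all }(\alpha,s)\in D,\ t\in[0,T],$$ in particular for all $\alpha\in\mathbb R$ and $s>0$ if $D=\mathbb R\times(0,\infty)$; if $D$ is bounded, this is claimed provided that it holds for $(\alpha,s)\in\partial D$. -/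

import Mathlib

open Set

noncomputable section

namespace UtilityIndifference

/-- Parameters of the market with proportional transaction costs `θ`, of the penalty method
(`lamB`, `lamC`), and of the option (maturity `T`, strike `K`). -/
structure Market where
  /-- volatility -/
  σ : ℝ
  /-- drift of the stock -/
  μ : ℝ
  /-- risk-free rate -/
  r : ℝ
  /-- bid-ask spread factor -/
  θ : ℝ
  /-- penalty parameter of the buy constraint -/
  lamB : ℝ
  /-- penalty parameter of the sell constraint -/
  lamC : ℝ
  /-- maturity -/
  T : ℝ
  /-- strike price -/
  K : ℝ
  σ_pos : 0 < σ
  μ_ne_zero : μ ≠ 0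
  θ_nonneg : 0 ≤ θ
  lamB_nonneg : 0 ≤ lamB
  lamC_nonneg : 0 ≤ lamC
  T_pos : 0 < T
  K_pos : 0 < K

/-- The two plain vanilla options. -/
inductive OptionKind
  | call
  | put

/-- Pay-off diagram: `(s - K)⁺` for a call, `(K - s)⁺` for a put. -/
def payoff (m : Market) : OptionKind → ℝ → ℝ
  | OptionKind.call, s => max (s - m.K) 0
  | OptionKind.put, s => max (m.K - s) 0

/-- The negative part, with the sign convention `[x]⁻ = min x 0 ≤ 0`. -/
def negativePart (x : ℝ) : ℝ := min x 0

/-- Absolute risk aversion `R = -U'' / U'`. -/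
def riskAversion (U : ℝ → ℝ) (ξ : ℝ) : ℝ := -(deriv (deriv U) ξ) / deriv U ξ

/-- An increasing utility function of class `C²`. -/
def IsUtility (U : ℝ → ℝ) : Prop := ContDiff ℝ 2 U ∧ ∀ ξ, 0 < deriv U ξ

/-- Liquid wealth `w = β + s (α - θ |α|)`. -/
def wealth (m : Market) (α β s : ℝ) : ℝ := β + s * (α - m.θ * |α|)

/-- The shift function `(β / μ) (r - μ) (1 - e^{-μ (T - t)})`. -/
def shift (m : Market) (β t : ℝ) : ℝ :=
  β / m.μ * (m.r - m.μ) * (1 - Real.exp (-m.μ * (m.T - t)))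

/-- The argument `z = e^{μ (T - t)} (w + 𝒜 + 𝒱)` of the utility function. -/
def utilityArg (m : Market) (V : ℝ → ℝ → ℝ → ℝ → ℝ) (α β s t : ℝ) : ℝ :=
  Real.exp (m.μ * (m.T - t)) * (wealth m α β s + shift m β t + V α β s t)

/-- `∂ₜ V + (σ²/2) s² ∂ₛ² V + μ s ∂ₛ V + r β ∂_β V`. -/
def opA (m : Market) (V : ℝ → ℝ → ℝ → ℝ → ℝ) (α β s t : ℝ) : ℝ :=
  deriv (fun x => V α β s x) t
    + m.σ ^ 2 / 2 * s ^ 2 * deriv (deriv fun x => V α β x t) s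
    + m.μ * s * deriv (fun x => V α β x t) s
    + m.r * β * deriv (fun x => V α x s t) β

/-- `-∂_α V + s (1 + θ) ∂_β V`. -/
def opB (m : Market) (V : ℝ → ℝ → ℝ → ℝ → ℝ) (α β s t : ℝ) : ℝ :=
  -deriv (fun x => V x β s t) α + s * (1 + m.θ) * deriv (fun x => V α x s t) β

/-- `∂_α V - s (1 - θ) ∂_β V`. -/
def opC (m : Market) (V : ℝ → ℝ → ℝ → ℝ → ℝ) (α β s t : ℝ) : ℝ :=
  deriv (fun x => V x β s t) α - s * (1 - m.θ) * deriv (fun x => V α x s t) β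

/-- The value of `opB` on the liquid wealth `w`; at the kink `α = 0` the left derivative of
`w` in `α` is used. -/
def opBWealth (m : Market) (α s : ℝ) : ℝ := if 0 < α then 2 * s * m.θ else 0

/-- The value of `opC` on the liquid wealth `w`; at the kink `α = 0` the left derivative of
`w` in `α` is used. -/
def opCWealth (m : Market) (α s : ℝ) : ℝ := if 0 < α then 0 else 2 * s * m.θ

/-- The left-hand side of the transformed penalized equation. Here `s ∂ₛ w = s (α - θ |α|)`. -/
def penalizedOp (m : Market) (U : ℝ → ℝ) (V : ℝ → ℝ → ℝ → ℝ → ℝ) (α β s t : ℝ) : ℝ :=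
  opA m V α β s t - m.μ * V α β s t
    - m.σ ^ 2 / 2 * riskAversion U (utilityArg m V α β s t) * Real.exp (m.μ * (m.T - t))
        * (s * (α - m.θ * |α|) + s * deriv (fun x => V α β x t) s) ^ 2
    + m.lamB * negativePart (opBWealth m α s + opB m V α β s t)
    + m.lamC * negativePart (opCWealth m α s + opC m V α β s t)

/-- A region of pairs `(α, s)`: the whole `ℝ × (0, ∞)`, or a bounded truncation of it that stays
away from `s = 0`. -/
def IsStateRegion (D : Set (ℝ × ℝ)) : Prop :=
  D = univ ×ˢ Ioi 0 ∨
    (IsOpen D ∧ Bornology.IsBounded D ∧ closure D ⊆ univ ×ˢ Ioi 0)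

/-- The part of the boundary of the region that lies in `ℝ × (0, ∞)`; it is empty when the region
is the whole `ℝ × (0, ∞)`. -/
def lateral (D : Set (ℝ × ℝ)) : Set (ℝ × ℝ) := frontier D ∩ univ ×ˢ Ioi 0

/-- `V` is a classical solution of the transformed penalized problem, for `(α, s) ∈ D`,
`β ∈ ℝ` and `0 ≤ t ≤ T`, with terminal value `δ C_T` and of polynomial growth. -/
structure IsPenalizedSolution (m : Market) (U : ℝ → ℝ) (kind : OptionKind) (δ : ℝ)
    (D : Set (ℝ × ℝ)) (V : ℝ → ℝ → ℝ → ℝ → ℝ) : Prop where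
  continuousOn : ContinuousOn (fun q : ℝ × ℝ × ℝ × ℝ => V q.1 q.2.1 q.2.2.1 q.2.2.2)
    {q | (q.1, q.2.2.1) ∈ D ∪ lateral D ∧ q.2.2.2 ∈ Icc 0 m.T}
  differentiableAt : ∀ α β s t, (α, s) ∈ D → t ∈ Ioo 0 m.T →
    DifferentiableAt ℝ (fun q : ℝ × ℝ × ℝ × ℝ => V q.1 q.2.1 q.2.2.1 q.2.2.2) (α, β, s, t)
  differentiableAt_deriv : ∀ α β s t, (α, s) ∈ D → t ∈ Ioo 0 m.T →
    DifferentiableAt ℝ (deriv fun x => V α β x t) s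
  equation : ∀ α β s t, (α, s) ∈ D → t ∈ Ioo 0 m.T → penalizedOp m U V α β s t = 0
  terminal : ∀ α β s, (α, s) ∈ D → V α β s m.T = δ * payoff m kind s
  growth : ∃ (C : ℝ) (k : ℕ), ∀ α β s t, (α, s) ∈ D → t ∈ Icc 0 m.T →
    |V α β s t| ≤ C * (1 + |α| + |β| + s + 1 / s) ^ k

/-- `u` is a classical solution, of polynomial growth, of the linear Black–Scholes equation with
drift `μ` on `s > 0`, `0 ≤ t ≤ T`, with terminal value `δ C_T`. -/
structure IsBlackScholesSolution (m : Market) (kind : OptionKind) (δ : ℝ)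
    (u : ℝ → ℝ → ℝ) : Prop where
  continuousOn : ContinuousOn (fun q : ℝ × ℝ => u q.1 q.2) (Ioi 0 ×ˢ Icc 0 m.T)
  differentiableAt : ∀ s t, 0 < s → t ∈ Ioo 0 m.T →
    DifferentiableAt ℝ (fun q : ℝ × ℝ => u q.1 q.2) (s, t)
  differentiableAt_deriv : ∀ s t, 0 < s → t ∈ Ioo 0 m.T →
    DifferentiableAt ℝ (deriv fun x => u x t) s
  equation : ∀ s t, 0 < s → t ∈ Ioo 0 m.T →
    deriv (fun x => u s x) t + m.σ ^ 2 / 2 * s ^ 2 * deriv (deriv fun x => u x t) s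
      + m.μ * s * deriv (fun x => u x t) s - m.μ * u s t = 0
  terminal : ∀ s, 0 < s → u s m.T = δ * payoff m kind s
  growth : ∃ (C : ℝ) (k : ℕ), ∀ s t, 0 < s → t ∈ Icc 0 m.T →
    |u s t| ≤ C * (1 + s + 1 / s) ^ k

/-- The value function `v = U(z)` that belongs to `V`. -/
def valueFunction (m : Market) (U : ℝ → ℝ) (V : ℝ → ℝ → ℝ → ℝ → ℝ) (α β s t : ℝ) : ℝ :=
  U (utilityArg m V α β s t)

/-- The certainty equivalent `w - U⁻¹(v)`, the solution `ζ` of `U (w - ζ) = v`. -/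
def certaintyEquivalent (m : Market) (U : ℝ → ℝ) (V : ℝ → ℝ → ℝ → ℝ → ℝ)
    (α β s t : ℝ) : ℝ :=
  wealth m α β s - Function.invFun U (valueFunction m U V α β s t)

/-- The option price, the discounted difference of the certainty equivalents with the option
(`V`) and without it (`V₀`). -/
def optionPrice (m : Market) (U : ℝ → ℝ) (V₀ V : ℝ → ℝ → ℝ → ℝ → ℝ) (α β s t : ℝ) : ℝ :=
  Real.exp (-m.r * (m.T - t)) *
    (certaintyEquivalent m U V α β s t - certaintyEquivalent m U V₀ α β s t)

end UtilityIndifference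

end

/-!
Every assertion follows from one maximum principle for functions `F(α, b, s, t)` on the unbounded
state space, `maximum_principle`: at a positive maximum of `F` minus a polynomially growing barrier
the first derivatives of `F` are those of the barrier, which are controlled by the barrier itself,
so a barrier growing fast enough in `T - t` contradicts the differential inequality for `F`.

*Independence of `β`.* Since `R` is constant, `β` itself enters the equation only in `r β ∂_β`.
Following the bank account along `β = b e^{r t}` and multiplying by `e^{μ (T - t)}` gives an equation
invariant under translations in `b` (`equation_characteristicForm`), and the maximum principle
compares a solution with its translate, which has the same terminal and lateral values. The penalty
terms are Lipschitz in the gradient, with coefficients of order `s` in the `b` direction. The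
quadratic term `γ (s ∂ₛ w + s ∂ₛ V)²` is not Lipschitz; it drops out if `γ = 0`, and also if `D`
is bounded, because then the barrier may be chosen independent of `s`, and the two `s`-derivatives agree
at the maximum.

There remains `γ > 0` in the whole region. There no solution exists (`false_of_pos`): for a short
position with terminal liquidation value `-2 s`, the function `e^{-γ z}` is a positive supersolution
of a linear equation with terminal value at least a multiple of `e^{γ s}`, which has infinite
expectation under a lognormal law. In elementary terms it dominates, for each `n`, the solution
with terminal value proportional to `γ^n s^n / n!`, whose growth factor `e^{c n²}` beats `n!`.

*Price.* `U` is injective, so the price is a multiple, depending on `t` only, of the difference of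
the two solutions (`optionPrice_eq`).

*Black–Scholes bound.* The risk term and the penalties have signs that make every solution a
subsolution of the linear equation on the slice `β = 0`, where the term `r β ∂_β` vanishes
(`le_blackScholes`).
-/

namespace UtilityIndifference

open Filter Topology

/-! ### Conditions at a maximum -/

theorem deriv_deriv_nonpos_of_isLocalMax {f : ℝ → ℝ} {x : ℝ} (h : IsLocalMax f x)
    (hc : ContinuousAt f x) : deriv (deriv f) x ≤ 0 := by
  by_contra! hpos
  have hmin : IsLocalMin f x := isLocalMin_of_deriv_deriv_pos hpos h.deriv_eq_zero hc
  have hconst : f =ᶠ[𝓝 x] fun _ => f x := by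
    filter_upwards [h, hmin] with y h1 h2 using le_antisymm h1 h2
  have h2 : deriv (deriv f) x = 0 := by
    rw [hconst.deriv.deriv_eq]
    simp
  linarith

theorem deriv_nonpos_of_forall_right_le {f : ℝ → ℝ} {t T : ℝ} (hf : DifferentiableAt ℝ f t)
    (ht : t < T) (hle : ∀ x ∈ Ioo t T, f x ≤ f t) : deriv f t ≤ 0 := by
  have h1 := hasDerivAt_iff_tendsto_slope.1 hf.hasDerivAt
  have h2 : Tendsto (slope f t) (𝓝[>] t) (𝓝 (deriv f t)) :=
    h1.mono_left (nhdsWithin_mono _ fun x hx => ne_of_gt hx)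
  refine le_of_tendsto h2 ?_
  filter_upwards [Ioo_mem_nhdsGT ht] with x hx
  rw [slope_def_field]
  exact div_nonpos_of_nonpos_of_nonneg (by linarith [hle x hx]) (by linarith [hx.1])

/-! ### The barrier -/

/-- The quantity whose powers measure growth at infinity and near `s = 0`. -/
noncomputable def size (α b s : ℝ) : ℝ := 1 + |α| + |b| + s + 1 / s

/-- A smooth weight, quadratic in `b`; the switch `χ ∈ [0, 1]` turns the dependence on `α` and `s`
on (`χ = 1`) or off (`χ = 0`). -/
noncomputable def weight (χ α b s : ℝ) : ℝ := 1 + b ^ 2 + χ * (α ^ 2 + s ^ 2 + s⁻¹ ^ 2)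

/-- The spatial part of the barrier subtracted from functions of growth order `k`. The exponent
`k + 2` exceeds the order, and avoids truncated subtraction in the second derivative. -/
noncomputable def barrier (χ : ℝ) (k : ℕ) (α b s : ℝ) : ℝ := weight χ α b s ^ (k + 2)

theorem one_le_size {α b s : ℝ} (hs : 0 < s) : 1 ≤ size α b s := by
  unfold size
  have := abs_nonneg α
  have := abs_nonneg b
  have : 0 < 1 / s := by positivity
  linarith

theorem one_le_weight {χ : ℝ} (hχ : 0 ≤ χ) (α b s : ℝ) : 1 ≤ weight χ α b s := by
  unfold weight
  have : 0 ≤ χ * (α ^ 2 + s ^ 2 + s⁻¹ ^ 2) := by positivity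
  nlinarith [sq_nonneg b]

theorem barrier_pos {χ : ℝ} (hχ : 0 ≤ χ) (k : ℕ) (α b s : ℝ) : 0 < barrier χ k α b s :=
  pow_pos (by linarith [one_le_weight hχ α b s]) _

theorem size_sq_le_weight (α b s : ℝ) :
    size α b s ^ 2 ≤ 5 * weight 1 α b s := by
  unfold size weight
  rw [one_div]
  generalize s⁻¹ = x
  rw [← sq_abs α, ← sq_abs b]
  generalize |α| = y, |b| = w
  nlinarith [sq_nonneg (1 - y), sq_nonneg (1 - w), sq_nonneg (1 - s), sq_nonneg (1 - x),
    sq_nonneg (y - w), sq_nonneg (y - s), sq_nonneg (y - x), sq_nonneg (w - s),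
    sq_nonneg (w - x), sq_nonneg (s - x)]

theorem hasDerivAt_barrier_left (χ : ℝ) (k : ℕ) (α b s : ℝ) :
    HasDerivAt (fun x => barrier χ k x b s)
      ((k + 2) * weight χ α b s ^ (k + 1) * (χ * (2 * α))) α := by
  have h : HasDerivAt (fun x => weight χ x b s) (χ * (2 * α)) α := by
    have := ((((hasDerivAt_id α).pow 2).add_const (s ^ 2)).add_const (s⁻¹ ^ 2)).const_mul χ
      |>.const_add (1 + b ^ 2)
    simpa [weight] using this
  exact (h.fun_pow (k + 2)).congr_deriv (by push_cast; rfl)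

theorem hasDerivAt_barrier_middle (χ : ℝ) (k : ℕ) (α b s : ℝ) :
    HasDerivAt (fun x => barrier χ k α x s)
      ((k + 2) * weight χ α b s ^ (k + 1) * (2 * b)) b := by
  have h : HasDerivAt (fun x => weight χ α x s) (2 * b) b := by
    have := (((hasDerivAt_id b).pow 2).const_add 1).add_const (χ * (α ^ 2 + s ^ 2 + s⁻¹ ^ 2))
    simpa [weight] using this
  exact (h.fun_pow (k + 2)).congr_deriv (by push_cast; rfl)

theorem hasDerivAt_weight_right (χ α b : ℝ) {s : ℝ} (hs : 0 < s) :
    HasDerivAt (fun x => weight χ α b x) (χ * (2 * s - 2 * s⁻¹ ^ 3)) s := by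
  have h := ((((hasDerivAt_id s).pow 2).const_add (α ^ 2)).add
    ((hasDerivAt_inv hs.ne').pow 2)).const_mul χ |>.const_add (1 + b ^ 2)
  refine (h.congr_deriv ?_).congr_of_eventuallyEq (Eventually.of_forall fun x => ?_)
  · simp
    left
    field_simp
    ring
  · simp [weight]

theorem hasDerivAt_barrier_right (χ : ℝ) (k : ℕ) (α b : ℝ) {s : ℝ} (hs : 0 < s) :
    HasDerivAt (fun x => barrier χ k α b x)
      ((k + 2) * weight χ α b s ^ (k + 1) * (χ * (2 * s - 2 * s⁻¹ ^ 3))) s := by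
  exact ((hasDerivAt_weight_right χ α b hs).fun_pow (k + 2)).congr_deriv (by push_cast; rfl)

theorem hasDerivAt_deriv_barrier_right (χ : ℝ) (k : ℕ) (α b : ℝ) {s : ℝ} (hs : 0 < s) :
    HasDerivAt (deriv fun x => barrier χ k α b x)
      ((k + 2) * ((k + 1) * weight χ α b s ^ k * (χ * (2 * s - 2 * s⁻¹ ^ 3)) ^ 2
        + weight χ α b s ^ (k + 1) * (χ * (2 + 6 * s⁻¹ ^ 4)))) s := by
  have he : (deriv fun x => barrier χ k α b x) =ᶠ[𝓝 s]
      fun x => (k + 2) * weight χ α b x ^ (k + 1) * (χ * (2 * x - 2 * x⁻¹ ^ 3)) := by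
    filter_upwards [Ioi_mem_nhds hs] with x hx
    exact (hasDerivAt_barrier_right χ k α b hx).deriv
  have h1 := (((hasDerivAt_weight_right χ α b hs).pow (k + 1)).const_mul ((k : ℝ) + 2)).mul
    ((((hasDerivAt_id s).const_mul 2).sub
      (((hasDerivAt_inv hs.ne').pow 3).const_mul 2)).const_mul χ)
  refine (h1.congr_deriv ?_).congr_of_eventuallyEq (he.trans (Eventually.of_forall fun x => ?_))
  · simp
    field_simp
    ring
  · simp

/-- The differential operator of the maximum principle maps the barrier to at most a multiple of
itself: each of `∂_α`, `s ∂_b`, `s ∂ₛ`, `s² ∂ₛ²` costs no more than a factor. -/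
theorem barrier_operator_le {χ : ℝ} (h0 : 0 ≤ χ) (h1 : χ ≤ 1) (k : ℕ) {a μ M Cw : ℝ}
    (ha : 0 ≤ a) (hM : 0 ≤ M) {α b s : ℝ} (hs : 0 < s)
    (hw : size α b s ^ 2 ≤ Cw * weight χ α b s) :
    a * s ^ 2 * deriv (deriv fun x => barrier χ k α b x) s
      + μ * s * deriv (fun x => barrier χ k α b x) s
      + M * (|deriv (fun x => barrier χ k x b s) α| + s * |deriv (fun x => barrier χ k α x s) b|)
      ≤ (k + 2) * (a * (4 * k + 10) + 2 * |μ| + M * (1 + Cw)) * barrier χ k α b s := by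
  rw [(hasDerivAt_barrier_left χ k α b s).deriv, (hasDerivAt_barrier_middle χ k α b s).deriv,
    (hasDerivAt_barrier_right χ k α b hs).deriv, (hasDerivAt_deriv_barrier_right χ k α b hs).deriv]
  have hW := one_le_weight h0 α b s
  have hbar : barrier χ k α b s = weight χ α b s ^ (k + 2) := rfl
  rw [hbar]
  have hi : 0 < s⁻¹ := by positivity
  have hsi : s * s⁻¹ = 1 := mul_inv_cancel₀ hs.ne'
  have hWdef : weight χ α b s = 1 + b ^ 2 + χ * (α ^ 2 + s ^ 2 + s⁻¹ ^ 2) := rfl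
  have hsz : size α b s = 1 + |α| + |b| + s + s⁻¹ := by simp [size]
  generalize weight χ α b s = W at *
  generalize s⁻¹ = x at *
  have hs2 : s * (χ * (2 * s - 2 * x ^ 3)) = χ * (2 * s ^ 2 - 2 * x ^ 2) := by
    linear_combination (-2 * χ * x ^ 2) * hsi
  have e1 : |χ * (2 * s ^ 2 - 2 * x ^ 2)| ≤ 2 * W := by
    have hχs : 0 ≤ χ * s ^ 2 := by positivity
    have hχx : 0 ≤ χ * x ^ 2 := by positivity
    have hχa : 0 ≤ χ * α ^ 2 := by positivity
    rw [abs_le]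
    constructor <;> nlinarith [sq_nonneg b]
  have e2 : s ^ 2 * (χ * (2 + 6 * x ^ 4)) ≤ 6 * W := by
    have hχs : 0 ≤ χ * s ^ 2 := by positivity
    have hχa : 0 ≤ χ * α ^ 2 := by positivity
    have : s ^ 2 * (χ * (2 + 6 * x ^ 4)) = χ * (2 * s ^ 2 + 6 * x ^ 2) := by
      linear_combination (6 * χ * x ^ 2 * (s * x + 1)) * hsi
    nlinarith [sq_nonneg b]
  have e3 : |χ * (2 * α)| ≤ W := by
    have hχs : 0 ≤ χ * s ^ 2 := by positivity
    have hχx : 0 ≤ χ * x ^ 2 := by positivity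
    rw [abs_le]
    constructor <;> nlinarith [sq_nonneg b, mul_nonneg h0 (sq_nonneg (α - 1)),
      mul_nonneg h0 (sq_nonneg (α + 1))]
  have e4 : s * |2 * b| ≤ Cw * W := by
    rw [abs_mul, abs_two]
    rw [hsz] at hw
    have hα := abs_nonneg α
    have hb := abs_nonneg b
    nlinarith [mul_nonneg hα hb, mul_nonneg hα hs.le, mul_nonneg hα hi.le, mul_nonneg hb hi.le,
      mul_nonneg hs.le hi.le, sq_nonneg |α|, sq_nonneg |b|, sq_nonneg s, sq_nonneg x,
      mul_nonneg hb hs.le]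
  have hWk : 0 < W ^ k := by positivity
  have hWk1 : 0 < W ^ (k + 1) := by positivity
  have e1' : (χ * (2 * s ^ 2 - 2 * x ^ 2)) ^ 2 ≤ 4 * W ^ 2 := by
    have := sq_le_sq' (by linarith [abs_le.1 e1 |>.1]) (abs_le.1 e1 |>.2)
    linarith
  have k2 : (0 : ℝ) ≤ (k : ℝ) + 2 := by positivity
  have t1 : a * s ^ 2 * ((k + 2) * ((k + 1) * W ^ k * (χ * (2 * s - 2 * x ^ 3)) ^ 2
      + W ^ (k + 1) * (χ * (2 + 6 * x ^ 4))))
      ≤ (k + 2) * (a * (4 * k + 10)) * W ^ (k + 2) := by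
    have : a * s ^ 2 * ((k + 2) * ((k + 1) * W ^ k * (χ * (2 * s - 2 * x ^ 3)) ^ 2
      + W ^ (k + 1) * (χ * (2 + 6 * x ^ 4)))) = (k + 2) * (a * ((k + 1) * (W ^ k *
        (χ * (2 * s ^ 2 - 2 * x ^ 2)) ^ 2)
          + W ^ (k + 1) * (s ^ 2 * (χ * (2 + 6 * x ^ 4))))) := by
      rw [← hs2]; ring
    rw [this]
    have h' : (k + 2) * (a * (4 * k + 10)) * W ^ (k + 2)
        = (k + 2) * (a * ((k + 1) * (W ^ k * (4 * W ^ 2)) + W ^ (k + 1) * (6 * W))) := by ring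
    rw [h']
    gcongr
  have t2 : μ * s * ((k + 2) * W ^ (k + 1) * (χ * (2 * s - 2 * x ^ 3)))
      ≤ (k + 2) * (2 * |μ|) * W ^ (k + 2) := by
    have hμ : μ * (χ * (2 * s ^ 2 - 2 * x ^ 2)) ≤ |μ| * (2 * W) := by
      refine (le_abs_self _).trans ?_
      rw [abs_mul]
      exact mul_le_mul_of_nonneg_left e1 (abs_nonneg μ)
    calc μ * s * ((k + 2) * W ^ (k + 1) * (χ * (2 * s - 2 * x ^ 3)))
        = (k + 2) * W ^ (k + 1) * (μ * (χ * (2 * s ^ 2 - 2 * x ^ 2))) := by rw [← hs2]; ring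
      _ ≤ (k + 2) * W ^ (k + 1) * (|μ| * (2 * W)) := by
          gcongr
      _ = _ := by ring
  have t3 : |(k + 2) * W ^ (k + 1) * (χ * (2 * α))| ≤ (k + 2) * W ^ (k + 2) := by
    rw [abs_mul, abs_of_nonneg (by positivity : (0 : ℝ) ≤ (k + 2) * W ^ (k + 1))]
    calc (k + 2) * W ^ (k + 1) * |χ * (2 * α)| ≤ (k + 2) * W ^ (k + 1) * W := by gcongr
      _ = _ := by ring
  have t4 : s * |(k + 2) * W ^ (k + 1) * (2 * b)| ≤ (k + 2) * Cw * W ^ (k + 2) := by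
    rw [abs_mul, abs_of_nonneg (by positivity : (0 : ℝ) ≤ (k + 2) * W ^ (k + 1))]
    calc s * ((k + 2) * W ^ (k + 1) * |2 * b|) = (k + 2) * W ^ (k + 1) * (s * |2 * b|) := by ring
      _ ≤ (k + 2) * W ^ (k + 1) * (Cw * W) := by gcongr
      _ = _ := by ring
  have t5 := mul_le_mul_of_nonneg_left (add_le_add t3 t4) hM
  have h' : (k + 2) * (a * (4 * k + 10) + 2 * |μ| + M * (1 + Cw)) * W ^ (k + 2)
      = (k + 2) * (a * (4 * k + 10)) * W ^ (k + 2) + (k + 2) * (2 * |μ|) * W ^ (k + 2)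
        + M * ((k + 2) * W ^ (k + 2) + (k + 2) * Cw * W ^ (k + 2)) := by ring
  rw [h']
  exact add_le_add (add_le_add t1 t2) t5

theorem deriv_barrier_zero (k : ℕ) (α b : ℝ) {s : ℝ} (hs : 0 < s) :
    deriv (fun x => barrier 0 k α b x) s = 0 := by
  rw [(hasDerivAt_barrier_right 0 k α b hs).deriv]
  simp

/-! ### The maximum principle -/

/-- The state space of the maximum principle, `(α, s) ∈ D` or on the lateral boundary, any `b`, and
`0 ≤ t ≤ T`. -/
def cylinder (D : Set (ℝ × ℝ)) (T : ℝ) : Set (ℝ × ℝ × ℝ × ℝ) :=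
  {q | (q.1, q.2.2.1) ∈ D ∪ lateral D ∧ q.2.2.2 ∈ Icc 0 T}

/-- Outside a large box the weight is large. -/
theorem weight_large {χ Cw R L : ℝ} (hCw : 0 < Cw) (hL : 0 ≤ L) {α b s : ℝ} (hs : 0 < s)
    (hw : size α b s ^ 2 ≤ Cw * weight χ α b s) (hR : 1 + Cw * L ≤ R)
    (hout : ¬ (α ∈ Icc (-R) R ∧ b ∈ Icc (-R) R ∧ s ∈ Icc (1 / R) R)) :
    L ≤ weight χ α b s := by
  have hR1 : 1 ≤ R := by nlinarith [mul_nonneg hCw.le hL]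
  have hbig : R ≤ size α b s := by
    by_contra! hlt
    have hi : 0 < 1 / s := by positivity
    have hα := abs_nonneg α
    have hb := abs_nonneg b
    unfold size at hlt
    refine hout ⟨abs_le.1 (by linarith), abs_le.1 (by linarith), ?_, by linarith⟩
    rw [div_le_iff₀ (by linarith)]
    have : 1 / s * s = 1 := by field_simp
    nlinarith
  have h2 : Cw * L ≤ Cw * weight χ α b s := by nlinarith
  exact le_of_mul_le_mul_left h2 hCw

/-- A function of growth order `k` is below any multiple of the barrier far out. -/
theorem le_barrier_of_weight_large {χ : ℝ} (hχ : 0 ≤ χ) {Cw C ε f : ℝ} {k : ℕ}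
    (hC : 0 ≤ C) (hε : 0 < ε) {α b s : ℝ} (hs : 0 < s)
    (hw : size α b s ^ 2 ≤ Cw * weight χ α b s)
    (hf : f ≤ C * size α b s ^ k) (hL : C * Cw ^ k / ε ≤ weight χ α b s) :
    f ≤ ε * barrier χ k α b s := by
  have h1 := one_le_size (α := α) (b := b) hs
  have hW := one_le_weight hχ α b s
  have h2 : size α b s ≤ Cw * weight χ α b s := by nlinarith
  unfold barrier
  calc f ≤ C * size α b s ^ k := hf
    _ ≤ C * (Cw * weight χ α b s) ^ k := by gcongr
    _ = (C * Cw ^ k) * weight χ α b s ^ k := by ring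
    _ ≤ (weight χ α b s * ε) * weight χ α b s ^ k := by
        exact mul_le_mul_of_nonneg_right ((div_le_iff₀ hε).1 hL) (by positivity)
    _ = ε * (weight χ α b s * 1) * weight χ α b s ^ k := by ring
    _ ≤ ε * (weight χ α b s * weight χ α b s) * weight χ α b s ^ k := by gcongr
    _ = _ := by ring

/-- Maximum principle on a state space that may be unbounded. The growth bound on `F` is one-sided.
The hypothesis on `N` allows an arbitrary multiple of `|∂ₛ F|` in the differential inequality if
the weight does not depend on `s`, and none otherwise. -/
theorem maximum_principle {D : Set (ℝ × ℝ)} (hDo : IsOpen D) (hDp : ∀ p ∈ D, 0 < p.2)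
    {T a μ M χ Cw C : ℝ} {k : ℕ} {N : ℝ → ℝ → ℝ → ℝ → ℝ} {F : ℝ → ℝ → ℝ → ℝ → ℝ}
    (ha : 0 ≤ a) (hM : 0 ≤ M) (hχ0 : 0 ≤ χ) (hχ1 : χ ≤ 1) (hCw : 0 < Cw)
    (hw : ∀ α b s, (α, s) ∈ D → size α b s ^ 2 ≤ Cw * weight χ α b s)
    (hN : χ = 0 ∨ ∀ α b s t, N α b s t = 0)
    (hcont : ContinuousOn (fun q : ℝ × ℝ × ℝ × ℝ => F q.1 q.2.1 q.2.2.1 q.2.2.2) (cylinder D T))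
    (hdiff : ∀ α b s t, (α, s) ∈ D → t ∈ Ioo 0 T →
      DifferentiableAt ℝ (fun q : ℝ × ℝ × ℝ × ℝ => F q.1 q.2.1 q.2.2.1 q.2.2.2) (α, b, s, t))
    (hdiff2 : ∀ α b s t, (α, s) ∈ D → t ∈ Ioo 0 T →
      DifferentiableAt ℝ (deriv fun x => F α b x t) s)
    (hterm : ∀ α b s, (α, s) ∈ D → F α b s T ≤ 0)
    (hlat : ∀ α b s t, (α, s) ∈ lateral D → t ∈ Icc 0 T → F α b s t ≤ 0)
    (hgrowth : ∀ α b s t, (α, s) ∈ D → t ∈ Icc 0 T → F α b s t ≤ C * size α b s ^ k)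
    (hineq : ∀ α b s t, (α, s) ∈ D → t ∈ Ioo 0 T →
      0 ≤ deriv (fun x => F α b s x) t + a * s ^ 2 * deriv (deriv fun x => F α b x t) s
        + μ * s * deriv (fun x => F α b x t) s
        + M * (|deriv (fun x => F x b s t) α| + s * |deriv (fun x => F α x s t) b|)
        + N α b s t * |deriv (fun x => F α b x t) s|)
    {α b s t : ℝ} (hD : (α, s) ∈ D) (ht : t ∈ Icc 0 T) : F α b s t ≤ 0 := by
  -- Positive times suffice, by continuity at `t = 0`.
  suffices key : ∀ α b s t, (α, s) ∈ D → t ∈ Ioc 0 T → F α b s t ≤ 0 by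
    rcases ht.1.eq_or_lt with h0 | h0
    · rcases ht.2.eq_or_lt with hT | hT
      · rw [hT]; exact hterm α b s hD
      · have hc : ContinuousWithinAt (fun x => F α b s x) (Icc 0 T) t :=
          (hcont (α, b, s, t) ⟨Or.inl hD, ht⟩).comp
            (f := fun x => ((α, b, s, x) : ℝ × ℝ × ℝ × ℝ)) (by fun_prop)
            fun x hx => ⟨Or.inl hD, hx⟩
        have hc' : Tendsto (fun x => F α b s x) (𝓝[>] t) (𝓝 (F α b s t)) := by
          have : Ioo t T ⊆ Icc 0 T := fun x hx => ⟨h0.le.trans hx.1.le, hx.2.le⟩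
          have h := (hc.mono this).tendsto
          rwa [nhdsWithin_Ioo_eq_nhdsGT hT] at h
        refine le_of_tendsto hc' ?_
        filter_upwards [Ioo_mem_nhdsGT hT] with x hx
        exact key α b s x hD ⟨h0.trans_lt hx.1, hx.2.le⟩
    · exact key α b s t hD ⟨h0, ht.2⟩
  intro α₀ b₀ s₀ t₀ hD₀ ht₀
  by_contra! hpos
  set C' := max C 0 with hC'
  have hC0 : 0 ≤ C' := le_max_right _ _
  have hs₀ : 0 < s₀ := hDp _ hD₀
  set A := (k + 2) * (a * (4 * k + 10) + 2 * |μ| + M * (1 + Cw)) + 1 with hA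
  have hA0 : 0 ≤ A := by positivity
  set e : ℝ → ℝ := fun t => Real.exp (A * (T - t)) with he
  have he1 : ∀ t ≤ T, 1 ≤ e t := fun t ht =>
    Real.one_le_exp (mul_nonneg hA0 (by linarith))
  obtain ⟨ε, hε, hε'⟩ : ∃ ε > 0, ε * (e t₀ * barrier χ k α₀ b₀ s₀) < F α₀ b₀ s₀ t₀ := by
    have hp : 0 < e t₀ * barrier χ k α₀ b₀ s₀ :=
      mul_pos (Real.exp_pos _) (barrier_pos hχ0 _ _ _ _)
    refine ⟨F α₀ b₀ s₀ t₀ / (2 * (e t₀ * barrier χ k α₀ b₀ s₀)), by positivity, ?_⟩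
    rw [div_mul_eq_mul_div, div_lt_iff₀ (by positivity)]
    nlinarith [mul_pos hpos hp]
  set G : ℝ → ℝ → ℝ → ℝ → ℝ := fun α b s t => F α b s t - ε * e t * barrier χ k α b s with hG
  have hG₀ : 0 < G α₀ b₀ s₀ t₀ := by simp only [hG]; linarith
  set L := C' * Cw ^ k / ε with hL
  have hL0 : 0 ≤ L := by positivity
  set R := size α₀ b₀ s₀ + Cw * L with hR
  have hsz₀ : 1 ≤ size α₀ b₀ s₀ := one_le_size hs₀
  have hCL : 0 ≤ Cw * L := by positivity
  have hR1 : 1 ≤ R := by linarith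
  have hGout : ∀ α b s t, (α, s) ∈ D → t ∈ Icc 0 T →
      ¬ (α ∈ Icc (-R) R ∧ b ∈ Icc (-R) R ∧ s ∈ Icc (1 / R) R) → G α b s t ≤ 0 := by
    intro α b s t hD ht hout
    have hs : 0 < s := hDp _ hD
    have h1 := weight_large hCw hL0 hs (hw α b s hD) (by linarith) hout
    have hg : F α b s t ≤ C' * size α b s ^ k := (hgrowth α b s t hD ht).trans (by
      have := one_le_size (α := α) (b := b) hs
      gcongr
      exact le_max_left _ _)
    have h2 := le_barrier_of_weight_large hχ0 hC0 hε hs (hw α b s hD) hg h1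
    have h3 : ε * 1 * barrier χ k α b s ≤ ε * e t * barrier χ k α b s := by
      have := (barrier_pos hχ0 k α b s).le
      gcongr
      exact he1 t ht.2
    simp only [hG]
    linarith
  -- The maximum of `G` is attained, on a compact box.
  set Kc : Set (ℝ × ℝ × ℝ × ℝ) :=
    (Icc (-R) R ×ˢ Icc (-R) R ×ˢ Icc (1 / R) R ×ˢ Icc t₀ T) ∩
      (fun q : ℝ × ℝ × ℝ × ℝ => (q.1, q.2.2.1)) ⁻¹' closure D with hKc
  have hK : IsCompact Kc :=
    (isCompact_Icc.prod (isCompact_Icc.prod (isCompact_Icc.prod isCompact_Icc))).inter_right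
      (isClosed_closure.preimage (by fun_prop))
  have hKcyl : Kc ⊆ cylinder D T := by
    rintro ⟨α, b, s, t⟩ ⟨⟨-, -, hs, ht⟩, hcl⟩
    have hs0 : 0 < s := lt_of_lt_of_le (by positivity) hs.1
    refine ⟨?_, ht₀.1.le.trans ht.1, ht.2⟩
    by_cases h : (α, s) ∈ D
    · exact Or.inl h
    · refine Or.inr ⟨?_, mem_univ _, hs0⟩
      rw [hDo.frontier_eq]
      exact ⟨hcl, h⟩
  have hmem : ∀ α b s t, (α, s) ∈ D → t ∈ Icc t₀ T →
      (α ∈ Icc (-R) R ∧ b ∈ Icc (-R) R ∧ s ∈ Icc (1 / R) R) → (α, b, s, t) ∈ Kc :=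
    fun α b s t hD ht h => ⟨⟨h.1, h.2.1, h.2.2, ht⟩, subset_closure hD⟩
  have hp₀ : (α₀, b₀, s₀, t₀) ∈ Kc := by
    refine hmem _ _ _ _ hD₀ ⟨le_rfl, ht₀.2⟩ ?_
    by_contra h
    exact absurd (hGout _ _ _ _ hD₀ ⟨ht₀.1.le, ht₀.2⟩ h) (not_le.2 hG₀)
  have hGcont : ContinuousOn (fun q : ℝ × ℝ × ℝ × ℝ => G q.1 q.2.1 q.2.2.1 q.2.2.2) Kc := by
    have hbar : ContinuousOn (fun q : ℝ × ℝ × ℝ × ℝ => barrier χ k q.1 q.2.1 q.2.2.1) Kc := by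
      unfold barrier weight
      have hinv : ContinuousOn (fun q : ℝ × ℝ × ℝ × ℝ => (q.2.2.1)⁻¹) Kc := by
        refine ContinuousOn.inv₀ (by fun_prop) ?_
        rintro ⟨α, b, s, t⟩ ⟨⟨-, -, hs, -⟩, -⟩
        exact (lt_of_lt_of_le (by positivity) hs.1 : (0 : ℝ) < s).ne'
      fun_prop
    have h1 := hcont.mono hKcyl
    simp only [hG, he]
    fun_prop
  obtain ⟨⟨α, b, s, t⟩, hp, hmax⟩ := hK.exists_isMaxOn ⟨_, hp₀⟩ hGcont
  have hGp : 0 < G α b s t := hG₀.trans_le (hmax hp₀)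
  have hFp : 0 < F α b s t := by
    have h1 : 0 < ε * e t * barrier χ k α b s :=
      mul_pos (mul_pos hε (Real.exp_pos _)) (barrier_pos hχ0 _ _ _ _)
    simp only [hG] at hGp
    linarith
  obtain ⟨hDL, htI⟩ := hKcyl hp
  have htt : t₀ ≤ t := hp.1.2.2.2.1
  simp only at hDL htI
  have hD : (α, s) ∈ D := by
    rcases hDL with h | h
    · exact h
    · exact absurd (hlat α b s t h htI) (not_le.2 hFp)
  have htT : t < T := by
    refine lt_of_le_of_ne htI.2 fun h => ?_
    subst h
    exact absurd (hterm α b s hD) (not_le.2 hFp)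
  have ht : t ∈ Ioo 0 T := ⟨ht₀.1.trans_le htt, htT⟩
  have hs : 0 < s := hDp _ hD
  have hmaxD : ∀ α' b' s' t', (α', s') ∈ D → t' ∈ Icc t₀ T → G α' b' s' t' ≤ G α b s t := by
    intro α' b' s' t' hD' ht'
    by_cases h : α' ∈ Icc (-R) R ∧ b' ∈ Icc (-R) R ∧ s' ∈ Icc (1 / R) R
    · exact hmax (hmem _ _ _ _ hD' ht' h)
    · exact (hGout _ _ _ _ hD' ⟨ht₀.1.le.trans ht'.1, ht'.2⟩ h).trans hGp.le
  have htI' : t ∈ Icc t₀ T := ⟨htt, htT.le⟩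
  have hDs : ∀ᶠ x in 𝓝 s, (α, x) ∈ D :=
    (Continuous.continuousAt (by fun_prop : Continuous fun x : ℝ => (α, x))).eventually
      (hDo.mem_nhds hD)
  have hDα : ∀ᶠ x in 𝓝 α, (x, s) ∈ D :=
    (Continuous.continuousAt (by fun_prop : Continuous fun x : ℝ => (x, s))).eventually
      (hDo.mem_nhds hD)
  have dα : DifferentiableAt ℝ (fun x => F x b s t) α :=
    (hdiff α b s t hD ht).comp (f := fun x => ((x, b, s, t) : ℝ × ℝ × ℝ × ℝ)) α (by fun_prop)
  have db : DifferentiableAt ℝ (fun x => F α x s t) b :=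
    (hdiff α b s t hD ht).comp (f := fun x => ((α, x, s, t) : ℝ × ℝ × ℝ × ℝ)) b (by fun_prop)
  have ds : ∀ y, (α, y) ∈ D → DifferentiableAt ℝ (fun x => F α b x t) y := fun y hy =>
    (hdiff α b y t hy ht).comp (f := fun x => ((α, b, x, t) : ℝ × ℝ × ℝ × ℝ)) y (by fun_prop)
  have dt : DifferentiableAt ℝ (fun x => F α b s x) t :=
    (hdiff α b s t hD ht).comp (f := fun x => ((α, b, s, x) : ℝ × ℝ × ℝ × ℝ)) t (by fun_prop)
  have bα := (hasDerivAt_barrier_left χ k α b s).differentiableAt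
  have bb := (hasDerivAt_barrier_middle χ k α b s).differentiableAt
  have bs : ∀ y, 0 < y → DifferentiableAt ℝ (fun x => barrier χ k α b x) y := fun y hy =>
    (hasDerivAt_barrier_right χ k α b hy).differentiableAt
  -- First and second order conditions at the maximum.
  have cα : deriv (fun x => F x b s t) α = ε * e t * deriv (fun x => barrier χ k x b s) α := by
    have h : IsLocalMax (fun x => G x b s t) α := by
      filter_upwards [hDα] with x hx using hmaxD x b s t hx htI'
    have h0 := h.deriv_eq_zero
    simp only [hG] at h0
    rw [deriv_fun_sub dα (bα.const_mul _), deriv_const_mul_field] at h0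
    linarith
  have cb : deriv (fun x => F α x s t) b = ε * e t * deriv (fun x => barrier χ k α x s) b := by
    have h : IsLocalMax (fun x => G α x s t) b :=
      Eventually.of_forall fun x => hmaxD α x s t hD htI'
    have h0 := h.deriv_eq_zero
    simp only [hG] at h0
    rw [deriv_fun_sub db (bb.const_mul _), deriv_const_mul_field] at h0
    linarith
  have hms : IsLocalMax (fun x => G α b x t) s := by
    filter_upwards [hDs] with x hx using hmaxD α b x t hx htI'
  have hderiv : deriv (fun x => G α b x t) =ᶠ[𝓝 s]
      fun y => deriv (fun x => F α b x t) y - ε * e t * deriv (fun x => barrier χ k α b x) y := by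
    filter_upwards [hDs] with y hy
    simp only [hG]
    rw [deriv_fun_sub (ds y hy) ((bs y (hDp _ hy)).const_mul _), deriv_const_mul_field]
  have cs : deriv (fun x => F α b x t) s = ε * e t * deriv (fun x => barrier χ k α b x) s := by
    have h0 := hms.deriv_eq_zero
    rw [hderiv.self_of_nhds] at h0
    linarith
  have css : deriv (deriv fun x => F α b x t) s
      ≤ ε * e t * deriv (deriv fun x => barrier χ k α b x) s := by
    have h0 := deriv_deriv_nonpos_of_isLocalMax hms
      (((ds s hD).sub ((bs s hs).const_mul (ε * e t))).continuousAt)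
    rw [hderiv.deriv_eq, deriv_fun_sub (hdiff2 α b s t hD ht)
      ((hasDerivAt_deriv_barrier_right χ k α b hs).differentiableAt.const_mul _),
      deriv_const_mul_field] at h0
    linarith
  have ct : deriv (fun x => F α b s x) t ≤ -(A * (ε * e t * barrier χ k α b s)) := by
    have hede : HasDerivAt (fun x => ε * e x * barrier χ k α b s)
        (ε * (e t * (A * -1)) * barrier χ k α b s) t :=
      ((((hasDerivAt_id t).const_sub T).const_mul A).exp.const_mul ε).mul_const _
    have h0 := deriv_nonpos_of_forall_right_le (f := fun x => G α b s x)
      (dt.sub hede.differentiableAt) htT fun x hx =>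
        hmaxD α b s x hD ⟨htt.trans hx.1.le, hx.2.le⟩
    simp only [hG] at h0
    rw [deriv_fun_sub dt hede.differentiableAt, hede.deriv] at h0
    linarith
  -- The barrier contradicts the differential inequality.
  have hee : 0 < ε * e t := mul_pos hε (Real.exp_pos _)
  have hN0 : N α b s t * |deriv (fun x => F α b x t) s| = 0 := by
    rcases hN with h | h
    · rw [cs, h, deriv_barrier_zero k α b hs]; simp
    · rw [h]; simp
  have hop := barrier_operator_le hχ0 hχ1 k (μ := μ) ha hM hs (hw α b s hD)
  have hin := hineq α b s t hD ht
  rw [hN0, cα, cb, cs, abs_mul (ε * e t), abs_mul (ε * e t), abs_of_pos hee] at hin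
  have hop' := mul_le_mul_of_nonneg_left hop hee.le
  have hss := mul_le_mul_of_nonneg_left css (by positivity : 0 ≤ a * s ^ 2)
  have hbp := mul_pos hee (barrier_pos hχ0 k α b s)
  have hAe : A * (ε * e t * barrier χ k α b s) =
      ε * e t * ((k + 2) * (a * (4 * k + 10) + 2 * |μ| + M * (1 + Cw)) * barrier χ k α b s)
        + ε * e t * barrier χ k α b s := by rw [hA]; ring
  rw [hAe] at ct
  have hexp : ε * e t * (a * s ^ 2 * deriv (deriv fun x => barrier χ k α b x) s
      + μ * s * deriv (fun x => barrier χ k α b x) s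
      + M * (|deriv (fun x => barrier χ k x b s) α| + s * |deriv (fun x => barrier χ k α x s) b|))
      = a * s ^ 2 * (ε * e t * deriv (deriv fun x => barrier χ k α b x) s)
        + μ * s * (ε * e t * deriv (fun x => barrier χ k α b x) s)
        + M * (ε * e t * |deriv (fun x => barrier χ k x b s) α|
          + s * (ε * e t * |deriv (fun x => barrier χ k α x s) b|)) := by ring
  rw [hexp] at hop'
  linarith

/-! ### State regions and the penalty term -/

theorem IsStateRegion.isOpen {D : Set (ℝ × ℝ)} (hD : IsStateRegion D) : IsOpen D := by
  rcases hD with rfl | h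
  · exact isOpen_univ.prod isOpen_Ioi
  · exact h.1

theorem IsStateRegion.pos {D : Set (ℝ × ℝ)} (hD : IsStateRegion D) : ∀ p ∈ D, 0 < p.2 := by
  rcases hD with rfl | h
  · exact fun p hp => hp.2
  · exact fun p hp => (h.2.2 (subset_closure hp)).2

/-- On a bounded region the weight need only grow in `b`. -/
theorem size_sq_le_weight_zero {D : Set (ℝ × ℝ)} (hb : Bornology.IsBounded D)
    (hcl : closure D ⊆ univ ×ˢ Ioi 0) :
    ∃ Cw : ℝ, 0 < Cw ∧ ∀ α b s, (α, s) ∈ D → size α b s ^ 2 ≤ Cw * weight 0 α b s := by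
  have hc : ContinuousOn (fun p : ℝ × ℝ => 1 + |p.1| + p.2 + 1 / p.2) (closure D) := by
    have : ContinuousOn (fun p : ℝ × ℝ => 1 / p.2) (closure D) :=
      ContinuousOn.div (by fun_prop) (by fun_prop) fun p hp => (hcl hp).2.ne'
    fun_prop
  obtain ⟨B, hB⟩ := hb.isCompact_closure.exists_bound_of_continuousOn hc
  refine ⟨2 * (B ^ 2 + 1), by positivity, fun α b s hD => ?_⟩
  have h1 := hB (α, s) (subset_closure hD)
  have hs : 0 < s := (hcl (subset_closure hD)).2
  have hi : 0 < 1 / s := by positivity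
  have hα := abs_nonneg α
  have hb := abs_nonneg b
  simp only [Real.norm_eq_abs] at h1
  rw [abs_of_nonneg (by positivity)] at h1
  have hle : size α b s ≤ B + |b| := by unfold size; linarith
  have h0 : 0 ≤ size α b s := by linarith [one_le_size (α := α) (b := b) hs]
  unfold weight
  rw [← sq_abs b]
  nlinarith [sq_nonneg (B - |b|), mul_nonneg (sq_nonneg B) (sq_nonneg |b|)]

theorem negativePart_mul {E : ℝ} (hE : 0 ≤ E) (x : ℝ) :
    negativePart (E * x) = E * negativePart x := by
  unfold negativePart
  rw [mul_min_of_nonneg _ _ hE, mul_zero]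

theorem negativePart_nonpos (x : ℝ) : negativePart x ≤ 0 := min_le_right _ _

theorem negativePart_sub_le (x y : ℝ) : negativePart x - negativePart y ≤ |x - y| := by
  have := abs_min_sub_min_le_max x 0 y 0
  simp only [sub_self, abs_zero, max_eq_left (abs_nonneg (x - y))] at this
  exact (le_abs_self _).trans this

/-! ### The equation in characteristic form -/

/-- The solution along the characteristics `β = b e^{r t}` of the bank account, in terminal
values. This removes the zero order term and the term with `r β ∂_β`, after which the equation is
invariant under translations in `b`. -/
noncomputable def characteristicForm (m : Market) (V : ℝ → ℝ → ℝ → ℝ → ℝ) (α b s t : ℝ) : ℝ :=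
  Real.exp (m.μ * (m.T - t)) * V α (b * Real.exp (m.r * t)) s t

variable {m : Market} {U : ℝ → ℝ} {kind : OptionKind} {δ γ : ℝ} {D : Set (ℝ × ℝ)}
  {V : ℝ → ℝ → ℝ → ℝ → ℝ}

theorem hasDerivAt_discount (m : Market) (t : ℝ) :
    HasDerivAt (fun x => Real.exp (m.μ * (m.T - x)))
      (-m.μ * Real.exp (m.μ * (m.T - t))) t := by
  have := (((hasDerivAt_id t).const_sub m.T).const_mul m.μ).exp
  exact this.congr_deriv (by simp [mul_comm])

theorem IsPenalizedSolution.continuousOn_characteristicForm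
    (hV : IsPenalizedSolution m U kind δ D V) :
    ContinuousOn (fun q : ℝ × ℝ × ℝ × ℝ => characteristicForm m V q.1 q.2.1 q.2.2.1 q.2.2.2)
      (cylinder D m.T) := by
  have h : ContinuousOn (fun q : ℝ × ℝ × ℝ × ℝ =>
      V q.1 (q.2.1 * Real.exp (m.r * q.2.2.2)) q.2.2.1 q.2.2.2) (cylinder D m.T) :=
    hV.continuousOn.comp (f := fun q : ℝ × ℝ × ℝ × ℝ =>
      ((q.1, q.2.1 * Real.exp (m.r * q.2.2.2), q.2.2.1, q.2.2.2) : ℝ × ℝ × ℝ × ℝ))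
      (by fun_prop) fun q hq => hq
  exact ContinuousOn.mul (f := fun q : ℝ × ℝ × ℝ × ℝ => Real.exp (m.μ * (m.T - q.2.2.2)))
    (by fun_prop) h

theorem IsPenalizedSolution.differentiableAt_characteristicForm
    (hV : IsPenalizedSolution m U kind δ D V) {α s t : ℝ} (b : ℝ) (hD : (α, s) ∈ D)
    (ht : t ∈ Ioo 0 m.T) :
    DifferentiableAt ℝ (fun q : ℝ × ℝ × ℝ × ℝ => characteristicForm m V q.1 q.2.1 q.2.2.1 q.2.2.2)
      (α, b, s, t) := by
  have h : DifferentiableAt ℝ (fun q : ℝ × ℝ × ℝ × ℝ =>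
      V q.1 (q.2.1 * Real.exp (m.r * q.2.2.2)) q.2.2.1 q.2.2.2) (α, b, s, t) :=
    (hV.differentiableAt α (b * Real.exp (m.r * t)) s t hD ht).comp
      (f := fun q : ℝ × ℝ × ℝ × ℝ =>
        ((q.1, q.2.1 * Real.exp (m.r * q.2.2.2), q.2.2.1, q.2.2.2) : ℝ × ℝ × ℝ × ℝ))
      (α, b, s, t) (by fun_prop)
  exact DifferentiableAt.mul (𝔸 := ℝ)
    (a := fun q : ℝ × ℝ × ℝ × ℝ => Real.exp (m.μ * (m.T - q.2.2.2))) (by fun_prop) h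

theorem IsPenalizedSolution.differentiableAt_deriv_characteristicForm
    (hV : IsPenalizedSolution m U kind δ D V) {α s t : ℝ} (b : ℝ) (hD : (α, s) ∈ D)
    (ht : t ∈ Ioo 0 m.T) :
    DifferentiableAt ℝ (deriv fun x => characteristicForm m V α b x t) s := by
  have : (deriv fun x => characteristicForm m V α b x t) = fun y =>
      Real.exp (m.μ * (m.T - t)) * deriv (fun x => V α (b * Real.exp (m.r * t)) x t) y := by
    funext y
    exact deriv_const_mul_field _
  rw [this]
  exact (hV.differentiableAt_deriv α _ s t hD ht).const_mul _

/-- The transformed penalized equation in characteristic form. -/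
theorem IsPenalizedSolution.equation_characteristicForm
    (hV : IsPenalizedSolution m U kind δ D V) (hR : ∀ ξ, riskAversion U ξ = γ) {α s t : ℝ} (b : ℝ)
    (hD : (α, s) ∈ D) (ht : t ∈ Ioo 0 m.T) :
    deriv (fun x => characteristicForm m V α b s x) t
      + m.σ ^ 2 / 2 * s ^ 2 * deriv (deriv fun x => characteristicForm m V α b x t) s
      + m.μ * s * deriv (fun x => characteristicForm m V α b x t) s
    = m.σ ^ 2 / 2 * γ * (Real.exp (m.μ * (m.T - t)) * (s * (α - m.θ * |α|))
          + s * deriv (fun x => characteristicForm m V α b x t) s) ^ 2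
      - m.lamB * negativePart (Real.exp (m.μ * (m.T - t)) * opBWealth m α s
          - deriv (fun x => characteristicForm m V x b s t) α
          + s * (1 + m.θ) * (Real.exp (-(m.r * t))
            * deriv (fun x => characteristicForm m V α x s t) b))
      - m.lamC * negativePart (Real.exp (m.μ * (m.T - t)) * opCWealth m α s
          + deriv (fun x => characteristicForm m V x b s t) α
          - s * (1 - m.θ) * (Real.exp (-(m.r * t))
            * deriv (fun x => characteristicForm m V α x s t) b)) := by
  set E := Real.exp (m.μ * (m.T - t)) with hE
  set β := b * Real.exp (m.r * t) with hβ
  have hE0 : 0 < E := Real.exp_pos _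
  obtain ⟨V', hV'⟩ := hV.differentiableAt α β s t hD ht
  have dt : HasDerivAt (fun x => V α β s x) (V' (0, 0, 0, 1)) t :=
    hV'.comp_hasDerivAt (f := fun x => ((α, β, s, x) : ℝ × ℝ × ℝ × ℝ)) t
      ((hasDerivAt_const t α).prodMk ((hasDerivAt_const t β).prodMk
        ((hasDerivAt_const t s).prodMk (hasDerivAt_id t))))
  have dβ : HasDerivAt (fun x => V α x s t) (V' (0, 1, 0, 0)) β :=
    hV'.comp_hasDerivAt (f := fun x => ((α, x, s, t) : ℝ × ℝ × ℝ × ℝ)) β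
      ((hasDerivAt_const β α).prodMk ((hasDerivAt_id β).prodMk
        ((hasDerivAt_const β s).prodMk (hasDerivAt_const β t))))
  have hb : HasDerivAt (fun x => b * Real.exp (m.r * x)) (m.r * β) t :=
    ((((hasDerivAt_id t).const_mul m.r).exp).const_mul b).congr_deriv (by simp [hβ]; ring)
  have dchar : HasDerivAt (fun x => V α (b * Real.exp (m.r * x)) s x)
      (V' (0, 0, 0, 1) + m.r * β * V' (0, 1, 0, 0)) t := by
    have h := hV'.comp_hasDerivAt
      (f := fun x => ((α, b * Real.exp (m.r * x), s, x) : ℝ × ℝ × ℝ × ℝ)) t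
      ((hasDerivAt_const t α).prodMk (hb.prodMk
        ((hasDerivAt_const t s).prodMk (hasDerivAt_id t))))
    refine h.congr_deriv ?_
    have : ((0, m.r * β, 0, 1) : ℝ × ℝ × ℝ × ℝ)
        = (0, 0, 0, 1) + (m.r * β) • (0, 1, 0, 0) := by simp
    rw [this, map_add, map_smul, smul_eq_mul]
  have ct : deriv (fun x => characteristicForm m V α b s x) t
      = E * (V' (0, 0, 0, 1) + m.r * β * V' (0, 1, 0, 0) - m.μ * V α β s t) := by
    have h := (hasDerivAt_discount m t).mul dchar
    refine (h.congr_deriv ?_).deriv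
    rw [← hE, ← hβ]
    ring
  have cb : deriv (fun x => characteristicForm m V α x s t) b
      = E * (V' (0, 1, 0, 0) * Real.exp (m.r * t)) := by
    have h : HasDerivAt (fun x => x * Real.exp (m.r * t)) (Real.exp (m.r * t)) b := by
      simpa using (hasDerivAt_id b).mul_const (Real.exp (m.r * t))
    exact ((dβ.comp b h).const_mul E).deriv
  have cα : deriv (fun x => characteristicForm m V x b s t) α
      = E * deriv (fun x => V x β s t) α := deriv_const_mul_field _
  have cs : (deriv fun x => characteristicForm m V α b x t)
      = fun y => E * deriv (fun x => V α β x t) y := by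
    funext y
    exact deriv_const_mul_field _
  have css : deriv (deriv fun x => characteristicForm m V α b x t) s
      = E * deriv (deriv fun x => V α β x t) s := by
    rw [cs]
    exact deriv_const_mul_field _
  rw [css, cs, ct, cb, cα]
  have hexp : Real.exp (-(m.r * t)) * Real.exp (m.r * t) = 1 := by
    rw [← Real.exp_add]; simp
  have e1 : Real.exp (-(m.r * t)) * (E * (V' (0, 1, 0, 0) * Real.exp (m.r * t)))
      = E * V' (0, 1, 0, 0) := by linear_combination (E * V' (0, 1, 0, 0)) * hexp
  rw [e1]
  have e2 : E * opBWealth m α s - E * deriv (fun x => V x β s t) α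
      + s * (1 + m.θ) * (E * V' (0, 1, 0, 0)) = E * (opBWealth m α s + opB m V α β s t) := by
    rw [opB, dβ.deriv]; ring
  have e3 : E * opCWealth m α s + E * deriv (fun x => V x β s t) α
      - s * (1 - m.θ) * (E * V' (0, 1, 0, 0)) = E * (opCWealth m α s + opC m V α β s t) := by
    rw [opC, dβ.deriv]; ring
  rw [e2, e3, negativePart_mul hE0.le, negativePart_mul hE0.le]
  have heq := hV.equation α β s t hD ht
  rw [penalizedOp, opA, hR, dt.deriv, dβ.deriv, ← hE] at heq
  linear_combination E * heq

/-- The penalties are nonpositive, so dropping them leaves an inequality. -/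
theorem IsPenalizedSolution.subsolution_characteristicForm
    (hV : IsPenalizedSolution m U kind δ D V) (hR : ∀ ξ, riskAversion U ξ = γ) {α s t : ℝ} (b : ℝ)
    (hD : (α, s) ∈ D) (ht : t ∈ Ioo 0 m.T) :
    m.σ ^ 2 / 2 * γ * (Real.exp (m.μ * (m.T - t)) * (s * (α - m.θ * |α|))
          + s * deriv (fun x => characteristicForm m V α b x t) s) ^ 2
    ≤ deriv (fun x => characteristicForm m V α b s x) t
      + m.σ ^ 2 / 2 * s ^ 2 * deriv (deriv fun x => characteristicForm m V α b x t) s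
      + m.μ * s * deriv (fun x => characteristicForm m V α b x t) s := by
  rw [hV.equation_characteristicForm hR b hD ht]
  have h1 := fun x => mul_nonpos_of_nonneg_of_nonpos m.lamB_nonneg (negativePart_nonpos x)
  have h2 := fun x => mul_nonpos_of_nonneg_of_nonpos m.lamC_nonneg (negativePart_nonpos x)
  linarith [h1 (Real.exp (m.μ * (m.T - t)) * opBWealth m α s
          - deriv (fun x => characteristicForm m V x b s t) α
          + s * (1 + m.θ) * (Real.exp (-(m.r * t))
            * deriv (fun x => characteristicForm m V α x s t) b)),
    h2 (Real.exp (m.μ * (m.T - t)) * opCWealth m α s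
          + deriv (fun x => characteristicForm m V x b s t) α
          - s * (1 - m.θ) * (Real.exp (-(m.r * t))
            * deriv (fun x => characteristicForm m V α x s t) b))]

theorem exp_le_exp_abs_mul {c t T : ℝ} (ht : t ∈ Icc 0 T) :
    Real.exp (c * t) ≤ Real.exp (|c| * T) := by
  refine Real.exp_le_exp.2 ((mul_le_mul_of_nonneg_right (le_abs_self c) ht.1).trans ?_)
  exact mul_le_mul_of_nonneg_left ht.2 (abs_nonneg c)

theorem discount_le {t : ℝ} (ht : t ∈ Icc 0 m.T) :
    Real.exp (m.μ * (m.T - t)) ≤ Real.exp (|m.μ| * m.T) :=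
  exp_le_exp_abs_mul ⟨by linarith [ht.2], by linarith [ht.1]⟩

theorem size_mul_le {α b s B h : ℝ} (hs : 0 < s) (hB : 1 ≤ B) :
    size α ((b + h) * B) s ≤ (1 + |h|) * B * size α b s := by
  have hi : 0 < 1 / s := by positivity
  have hα := abs_nonneg α
  have hb := abs_nonneg b
  have hh := abs_nonneg h
  have h1 : |(b + h) * B| ≤ (|b| + |h|) * B := by
    rw [abs_mul, abs_of_nonneg (by linarith : 0 ≤ B)]
    gcongr
    exact abs_add_le b h
  unfold size
  have h2 : 0 ≤ (|α| + s + 1 / s + 1) * (B - 1) := by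
    apply mul_nonneg <;> linarith
  have h3 : 0 ≤ |h| * B * (|α| + |b| + s + 1 / s) := by positivity
  nlinarith

theorem IsPenalizedSolution.growth_characteristicForm (hDp : ∀ p ∈ D, 0 < p.2)
    (hV : IsPenalizedSolution m U kind δ D V) :
    ∃ (C : ℝ) (k : ℕ), 0 ≤ C ∧ ∀ h α b s t, (α, s) ∈ D → t ∈ Icc 0 m.T →
      |characteristicForm m V α (b + h) s t| ≤ C * (1 + |h|) ^ k * size α b s ^ k := by
  obtain ⟨C, k, hC⟩ := hV.growth
  set B := Real.exp (|m.r| * m.T) with hB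
  have hB1 : 1 ≤ B := Real.one_le_exp (mul_nonneg (abs_nonneg _) m.T_pos.le)
  refine ⟨Real.exp (|m.μ| * m.T) * |C| * B ^ k, k, by positivity, fun h α b s t hD ht => ?_⟩
  have hs := hDp _ hD
  have h1 : size α ((b + h) * Real.exp (m.r * t)) s ≤ (1 + |h|) * B * size α b s := by
    refine le_trans ?_ (size_mul_le hs hB1)
    unfold size
    gcongr 1 + |α| + ?_ + s + 1 / s
    rw [abs_mul, abs_mul, abs_of_pos (Real.exp_pos _), abs_of_pos (by linarith : 0 < B)]
    gcongr
    exact exp_le_exp_abs_mul ht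
  have h0 := one_le_size (α := α) (b := (b + h) * Real.exp (m.r * t)) hs
  have h2 : |V α ((b + h) * Real.exp (m.r * t)) s t|
      ≤ |C| * ((1 + |h|) * B * size α b s) ^ k := by
    calc |V α ((b + h) * Real.exp (m.r * t)) s t|
        ≤ C * size α ((b + h) * Real.exp (m.r * t)) s ^ k := hC _ _ _ _ hD ht
      _ ≤ |C| * size α ((b + h) * Real.exp (m.r * t)) s ^ k := by
          gcongr
          exact le_abs_self C
      _ ≤ _ := by gcongr
  rw [characteristicForm, abs_mul, abs_of_pos (Real.exp_pos _)]
  calc _ ≤ Real.exp (|m.μ| * m.T) * (|C| * ((1 + |h|) * B * size α b s) ^ k) := by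
        exact mul_le_mul (discount_le ht) h2 (abs_nonneg _) (Real.exp_pos _).le
    _ = _ := by rw [mul_pow, mul_pow]; ring

theorem IsPenalizedSolution.characteristicForm_terminal (hV : IsPenalizedSolution m U kind δ D V)
    {α s : ℝ} (b : ℝ) (hD : (α, s) ∈ D) :
    characteristicForm m V α b s m.T = δ * payoff m kind s := by
  simp [characteristicForm, hV.terminal _ _ _ hD]

/-! ### Comparison with translates -/

/-- Comparison of a solution with its translates in `b`. The quadratic gradient term is harmless if
it is absent (`γ = 0`), or if the barrier need not depend on `s` (`D` bounded). -/
theorem IsPenalizedSolution.characteristicForm_le_translate (hDS : IsStateRegion D)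
    (hV : IsPenalizedSolution m U kind δ D V) (hγ : 0 ≤ γ)
    (hR : ∀ ξ, riskAversion U ξ = γ)
    (hcase : γ = 0 ∨ (Bornology.IsBounded D ∧ closure D ⊆ univ ×ˢ Ioi 0))
    (hlat : ∀ α s, (α, s) ∈ lateral D → ∀ β β', ∀ t ∈ Icc 0 m.T, V α β s t = V α β' s t)
    {α s t : ℝ} (b h : ℝ) (hD : (α, s) ∈ D) (ht : t ∈ Icc 0 m.T) :
    characteristicForm m V α b s t ≤ characteristicForm m V α (b + h) s t := by
  obtain ⟨χ, Cw, hχ0, hχ1, hCw, hw, hN⟩ : ∃ χ Cw : ℝ, 0 ≤ χ ∧ χ ≤ 1 ∧ 0 < Cw ∧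
      (∀ α b s, (α, s) ∈ D → size α b s ^ 2 ≤ Cw * weight χ α b s) ∧ (χ = 0 ∨ γ = 0) := by
    rcases hcase with h0 | ⟨h1, h2⟩
    · exact ⟨1, 5, by norm_num, le_rfl, by norm_num, fun α b s _ => size_sq_le_weight α b s,
        Or.inr h0⟩
    · obtain ⟨Cw, hCw, hw⟩ := size_sq_le_weight_zero h1 h2
      exact ⟨0, Cw, le_rfl, zero_le_one, hCw, hw, Or.inl rfl⟩
  obtain ⟨C, k, hC0, hC⟩ := hV.growth_characteristicForm hDS.pos
  set v := characteristicForm m V with hv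
  set B := Real.exp (|m.r| * m.T) with hB
  have hB1 : 1 ≤ B := Real.one_le_exp (mul_nonneg (abs_nonneg _) m.T_pos.le)
  have hθ := m.θ_nonneg
  have hM1 : 1 ≤ (1 + m.θ) * B := by nlinarith
  suffices hF : v α b s t - v α (b + h) s t ≤ 0 by linarith
  have hcont := hV.continuousOn_characteristicForm
  have hshift : ∀ α b s t, (α, s) ∈ D → t ∈ Ioo 0 m.T → DifferentiableAt ℝ
      (fun q : ℝ × ℝ × ℝ × ℝ => v q.1 (q.2.1 + h) q.2.2.1 q.2.2.2) (α, b, s, t) :=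
    fun α b s t hD ht => (hV.differentiableAt_characteristicForm (b + h) hD ht).comp
      (f := fun q : ℝ × ℝ × ℝ × ℝ => ((q.1, q.2.1 + h, q.2.2.1, q.2.2.2) : ℝ × ℝ × ℝ × ℝ))
      (α, b, s, t) (by fun_prop)
  have ds : ∀ α b s t, (α, s) ∈ D → t ∈ Ioo 0 m.T →
      DifferentiableAt ℝ (fun x => v α b x t) s := fun α b s t hD ht =>
    (hV.differentiableAt_characteristicForm b hD ht).comp
      (f := fun x => ((α, b, x, t) : ℝ × ℝ × ℝ × ℝ)) s (by fun_prop)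
  have dα : ∀ α b s t, (α, s) ∈ D → t ∈ Ioo 0 m.T →
      DifferentiableAt ℝ (fun x => v x b s t) α := fun α b s t hD ht =>
    (hV.differentiableAt_characteristicForm b hD ht).comp
      (f := fun x => ((x, b, s, t) : ℝ × ℝ × ℝ × ℝ)) α (by fun_prop)
  have db : ∀ α b s t, (α, s) ∈ D → t ∈ Ioo 0 m.T →
      DifferentiableAt ℝ (fun x => v α x s t) b := fun α b s t hD ht =>
    (hV.differentiableAt_characteristicForm b hD ht).comp
      (f := fun x => ((α, x, s, t) : ℝ × ℝ × ℝ × ℝ)) b (by fun_prop)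
  have dt : ∀ α b s t, (α, s) ∈ D → t ∈ Ioo 0 m.T →
      DifferentiableAt ℝ (fun x => v α b s x) t := fun α b s t hD ht =>
    (hV.differentiableAt_characteristicForm b hD ht).comp
      (f := fun x => ((α, b, s, x) : ℝ × ℝ × ℝ × ℝ)) t (by fun_prop)
  have hderiv : ∀ α b s t, (α, s) ∈ D → t ∈ Ioo 0 m.T →
      (deriv fun x => v α b x t - v α (b + h) x t) =ᶠ[𝓝 s]
        fun y => deriv (fun x => v α b x t) y - deriv (fun x => v α (b + h) x t) y := by
    intro α b s t hD ht
    have hDs : ∀ᶠ x in 𝓝 s, (α, x) ∈ D :=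
      (Continuous.continuousAt (by fun_prop : Continuous fun x : ℝ => (α, x))).eventually
        (hDS.isOpen.mem_nhds hD)
    filter_upwards [hDs] with y hy
    exact deriv_fun_sub (ds α b y t hy ht) (ds α (b + h) y t hy ht)
  refine maximum_principle (F := fun α b s t => v α b s t - v α (b + h) s t)
    (T := m.T) (a := m.σ ^ 2 / 2) (μ := m.μ) (M := (m.lamB + m.lamC) * ((1 + m.θ) * B))
    (C := C + C * (1 + |h|) ^ k) (k := k)
    (N := fun α b s t => m.σ ^ 2 / 2 * γ * s * |2 * (Real.exp (m.μ * (m.T - t))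
      * (s * (α - m.θ * |α|))) + s * deriv (fun x => v α b x t) s
        + s * deriv (fun x => v α (b + h) x t) s|)
    hDS.isOpen hDS.pos (by positivity)
    (mul_nonneg (add_nonneg m.lamB_nonneg m.lamC_nonneg) (by linarith)) hχ0 hχ1 hCw hw
    (hN.imp id fun h0 => by simp [h0]) ?_ ?_ ?_ ?_ ?_ ?_ ?_ hD ht
  · have h2 : ContinuousOn (fun q : ℝ × ℝ × ℝ × ℝ => v q.1 (q.2.1 + h) q.2.2.1 q.2.2.2)
        (cylinder D m.T) :=
      hcont.comp (f := fun q : ℝ × ℝ × ℝ × ℝ =>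
        ((q.1, q.2.1 + h, q.2.2.1, q.2.2.2) : ℝ × ℝ × ℝ × ℝ)) (by fun_prop) fun q hq => hq
    exact hcont.sub h2
  · intro α b s t hD ht
    exact (hV.differentiableAt_characteristicForm b hD ht).sub (hshift α b s t hD ht)
  · intro α b s t hD ht
    exact ((hV.differentiableAt_deriv_characteristicForm b hD ht).sub
      (hV.differentiableAt_deriv_characteristicForm (b + h) hD ht)).congr_of_eventuallyEq
        (hderiv α b s t hD ht)
  · intro α b s hD
    simp only [hv, hV.characteristicForm_terminal _ hD, sub_self, le_refl]
  · intro α b s t hl ht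
    simp only [hv, characteristicForm]
    rw [hlat α s hl _ ((b + h) * Real.exp (m.r * t)) t ht, sub_self]
  · intro α b s t hD ht
    have h1 := hC 0 α b s t hD ht
    have h2 := hC h α b s t hD ht
    simp only [add_zero, abs_zero, one_pow, mul_one] at h1
    calc _ ≤ |v α b s t| + |v α (b + h) s t| := by
          linarith [le_abs_self (v α b s t), neg_abs_le (v α (b + h) s t)]
      _ ≤ C * size α b s ^ k + C * (1 + |h|) ^ k * size α b s ^ k := add_le_add h1 h2
      _ = _ := by ring
  · intro α b s t hD ht
    have hs : 0 < s := hDS.pos _ hD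
    have q1 := hV.equation_characteristicForm hR b hD ht
    have q2 := hV.equation_characteristicForm hR (b + h) hD ht
    rw [← hv] at q1 q2
    have c1 : deriv (fun x => v α b x t - v α (b + h) x t) s
        = deriv (fun x => v α b x t) s - deriv (fun x => v α (b + h) x t) s :=
      (hderiv α b s t hD ht).self_of_nhds
    have c2 : deriv (deriv fun x => v α b x t - v α (b + h) x t) s
        = deriv (deriv fun x => v α b x t) s - deriv (deriv fun x => v α (b + h) x t) s := by
      rw [(hderiv α b s t hD ht).deriv_eq]
      exact deriv_fun_sub (hV.differentiableAt_deriv_characteristicForm b hD ht)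
        (hV.differentiableAt_deriv_characteristicForm (b + h) hD ht)
    have c3 : deriv (fun x => v x b s t - v x (b + h) s t) α
        = deriv (fun x => v x b s t) α - deriv (fun x => v x (b + h) s t) α :=
      deriv_fun_sub (dα α b s t hD ht) (dα α (b + h) s t hD ht)
    have c4 : deriv (fun x => v α x s t - v α (x + h) s t) b
        = deriv (fun x => v α x s t) b - deriv (fun x => v α x s t) (b + h) := by
      have h2 : HasDerivAt (fun x => v α (x + h) s t) (deriv (fun x => v α x s t) (b + h)) b :=
        HasDerivAt.comp_add_const b h (db α (b + h) s t hD ht).hasDerivAt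
      rw [deriv_fun_sub (db α b s t hD ht) h2.differentiableAt, h2.deriv]
    have c5 : deriv (fun x => v α b s x - v α (b + h) s x) t
        = deriv (fun x => v α b s x) t - deriv (fun x => v α (b + h) s x) t :=
      deriv_fun_sub (dt α b s t hD ht) (dt α (b + h) s t hD ht)
    rw [c1, c2, c3, c4, c5]
    generalize deriv (fun x => v α b s x) t = v1t at *
    generalize deriv (fun x => v α (b + h) s x) t = v2t at *
    generalize deriv (deriv fun x => v α b x t) s = v1ss at *
    generalize deriv (deriv fun x => v α (b + h) x t) s = v2ss at *
    generalize deriv (fun x => v α b x t) s = v1s at *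
    generalize deriv (fun x => v α (b + h) x t) s = v2s at *
    generalize deriv (fun x => v x b s t) α = v1a at *
    generalize deriv (fun x => v x (b + h) s t) α = v2a at *
    generalize deriv (fun x => v α x s t) b = v1b at *
    generalize deriv (fun x => v α x s t) (b + h) = v2b at *
    generalize Real.exp (m.μ * (m.T - t)) = E at *
    have hr : Real.exp (-(m.r * t)) ≤ B := by
      have := exp_le_exp_abs_mul (c := -m.r) ⟨ht.1.le, ht.2.le⟩
      rwa [neg_mul, abs_neg] at this
    have hr0 : 0 < Real.exp (-(m.r * t)) := Real.exp_pos _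
    generalize Real.exp (-(m.r * t)) = ρ at *
    -- Both penalty terms are Lipschitz in the gradient.
    have pen : ∀ x y c' : ℝ, |c'| ≤ 1 + m.θ → |x| = |v1a - v2a| → y = s * c' * (ρ * (v1b - v2b)) →
        |x + y| ≤ (1 + m.θ) * B * (|v1a - v2a| + s * |v1b - v2b|) := by
      intro x y c' hc' hx hy
      have h1 : |y| ≤ (1 + m.θ) * B * (s * |v1b - v2b|) := by
        rw [hy, abs_mul, abs_mul, abs_mul, abs_of_pos hs, abs_of_pos hr0]
        calc s * |c'| * (ρ * |v1b - v2b|) ≤ s * (1 + m.θ) * (B * |v1b - v2b|) := by gcongr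
          _ = _ := by ring
      have h2 : |x| ≤ (1 + m.θ) * B * |v1a - v2a| := by
        rw [hx]
        exact le_mul_of_one_le_left (abs_nonneg _) hM1
      calc |x + y| ≤ |x| + |y| := abs_add_le x y
        _ ≤ _ := by linarith
    have pB := (negativePart_sub_le (E * opBWealth m α s - v1a + s * (1 + m.θ) * (ρ * v1b))
      (E * opBWealth m α s - v2a + s * (1 + m.θ) * (ρ * v2b))).trans (by
        have := pen (-(v1a - v2a)) (s * (1 + m.θ) * (ρ * (v1b - v2b))) (1 + m.θ)
          (abs_of_nonneg (by linarith)).le (abs_neg _) rfl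
        refine le_trans (le_of_eq ?_) this
        congr 1
        ring)
    have pC := (negativePart_sub_le (E * opCWealth m α s + v1a - s * (1 - m.θ) * (ρ * v1b))
      (E * opCWealth m α s + v2a - s * (1 - m.θ) * (ρ * v2b))).trans (by
        have := pen (v1a - v2a) (s * (-(1 - m.θ)) * (ρ * (v1b - v2b))) (-(1 - m.θ))
          (abs_le.2 ⟨by linarith, by linarith⟩) rfl rfl
        refine le_trans (le_of_eq ?_) this
        congr 1
        ring)
    have pB' := mul_le_mul_of_nonneg_left pB m.lamB_nonneg
    have pC' := mul_le_mul_of_nonneg_left pC m.lamC_nonneg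
    have hquad : -(m.σ ^ 2 / 2 * γ * s * |2 * (E * (s * (α - m.θ * |α|))) + s * v1s + s * v2s|
        * |v1s - v2s|) ≤ m.σ ^ 2 / 2 * γ * (E * (s * (α - m.θ * |α|)) + s * v1s) ^ 2
          - m.σ ^ 2 / 2 * γ * (E * (s * (α - m.θ * |α|)) + s * v2s) ^ 2 := by
      have h1 := mul_le_mul_of_nonneg_left
        (neg_abs_le ((2 * (E * (s * (α - m.θ * |α|))) + s * v1s + s * v2s) * (v1s - v2s)))
        (by positivity : 0 ≤ m.σ ^ 2 / 2 * γ * s)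
      rw [abs_mul] at h1
      linarith
    linarith

/-! ### Nonexistence for `γ > 0` in the whole region -/

/-- The moments of order `n` of a geometric Brownian motion, of size `e^{c n²}`, outgrow `n!`. -/
theorem exists_lt_moment {a γ T : ℝ} (ha : 0 < a) (hγ : 0 < γ) (hT : 0 < T) (μ B : ℝ) :
    ∃ n : ℕ, B < γ ^ (n + 2) / (n + 2).factorial
      * Real.exp ((a * ((n + 2) * (n + 1)) + μ * (n + 2)) * T) := by
  set q := Real.exp (a * T) with hq
  set c := γ * Real.exp ((μ - a) * T) with hc
  have hc0 : 0 < c := by positivity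
  have hq1 : 1 < q := Real.one_lt_exp_iff.2 (by positivity)
  have h1 := tendsto_pow_const_div_const_pow_of_one_lt 1 hq1
  have h2 : ∀ᶠ n : ℕ in atTop, (n : ℝ) ^ 1 / q ^ n < c / 2 := h1.eventually_lt_const (by positivity)
  have h3 : ∀ᶠ n : ℕ in atTop, B < (2 : ℝ) ^ n :=
    (tendsto_pow_atTop_atTop_of_one_lt one_lt_two).eventually_gt_atTop B
  obtain ⟨N, ⟨hN1, hN2⟩, hN⟩ := ((h2.and h3).and (eventually_ge_atTop 2)).exists
  obtain ⟨n, rfl⟩ := Nat.exists_eq_add_of_le' hN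
  refine ⟨n, hN2.trans_le ?_⟩
  have hqN : 0 < q ^ (n + 2) := by positivity
  rw [pow_one, div_lt_iff₀ hqN] at hN1
  have hf : ((n + 2).factorial : ℝ) ≤ ((n + 2 : ℕ) : ℝ) ^ (n + 2) := by
    exact_mod_cast Nat.factorial_le_pow (n + 2)
  have hf0 : (0 : ℝ) < (n + 2).factorial := by positivity
  have hexp : γ ^ (n + 2) * Real.exp ((a * ((n + 2) * (n + 1)) + μ * (n + 2)) * T)
      = (c * q ^ (n + 2)) ^ (n + 2) := by
    rw [hc, hq, mul_pow, mul_pow, ← Real.exp_nat_mul, ← Real.exp_nat_mul, ← Real.exp_nat_mul,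
      mul_assoc, ← Real.exp_add]
    congr 2
    push_cast
    ring
  rw [div_mul_eq_mul_div, hexp, le_div_iff₀ hf0]
  calc (2 : ℝ) ^ (n + 2) * (n + 2).factorial ≤ 2 ^ (n + 2) * ((n + 2 : ℕ) : ℝ) ^ (n + 2) := by gcongr
    _ = (2 * ((n + 2 : ℕ) : ℝ)) ^ (n + 2) := by rw [mul_pow]
    _ ≤ (c * q ^ (n + 2)) ^ (n + 2) := by
        refine pow_le_pow_left₀ (by positivity) ?_ _
        linarith

theorem abs_payoff_le (m : Market) (kind : OptionKind) {s : ℝ} (hs : 0 < s) :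
    |payoff m kind s| ≤ s + m.K := by
  have := m.K_pos
  cases kind <;> simp only [payoff] <;> rw [abs_of_nonneg (le_max_right _ _)] <;>
    apply max_le <;> linarith

theorem lateral_univ_prod_Ioi : lateral (univ ×ˢ Ioi (0 : ℝ)) = ∅ := by
  rw [lateral, (isOpen_univ.prod isOpen_Ioi).frontier_eq]
  ext p
  simp

/-- A function `v` with the quadratic inequality, shifted by the value `d s c` of the stock, becomes, by the exponential transformation, a
positive supersolution of the linear equation. -/
theorem exp_supersolution {a γ μ s t E : ℝ} {v : ℝ → ℝ → ℝ} (d : ℝ → ℝ) (hγ : 0 ≤ γ)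
    (hd : HasDerivAt d (-μ * E) t) (hE : d t = E)
    (hs : ∀ᶠ x in 𝓝 s, DifferentiableAt ℝ (fun x => v x t) x)
    (hss : DifferentiableAt ℝ (deriv fun x => v x t) s)
    (ht : DifferentiableAt ℝ (fun x => v s x) t) (c : ℝ)
    (hv : a * γ * (E * (s * c) + s * deriv (fun x => v x t) s) ^ 2
      ≤ deriv (fun x => v s x) t + a * s ^ 2 * deriv (deriv fun x => v x t) s
        + μ * s * deriv (fun x => v x t) s) :
    DifferentiableAt ℝ (deriv fun x => Real.exp (-γ * (v x t + d t * (x * c)))) s ∧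
    deriv (fun x => Real.exp (-γ * (v s x + d x * (s * c)))) t
      + a * s ^ 2 * deriv (deriv fun x => Real.exp (-γ * (v x t + d t * (x * c)))) s
      + μ * s * deriv (fun x => Real.exp (-γ * (v x t + d t * (x * c)))) s ≤ 0 := by
  have hz : ∀ x, DifferentiableAt ℝ (fun x => v x t) x →
      HasDerivAt (fun x => Real.exp (-γ * (v x t + d t * (x * c))))
        (Real.exp (-γ * (v x t + d t * (x * c)))
          * (-γ * (deriv (fun x => v x t) x + d t * c))) x := by
    intro x hx
    have h := ((hx.hasDerivAt.add (((hasDerivAt_id x).mul_const c).const_mul (d t))).const_mul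
      (-γ)).exp
    exact h.congr_deriv (by simp)
  have he : (deriv fun x => Real.exp (-γ * (v x t + d t * (x * c)))) =ᶠ[𝓝 s]
      fun x => Real.exp (-γ * (v x t + d t * (x * c)))
          * (-γ * (deriv (fun x => v x t) x + d t * c)) := by
    filter_upwards [hs] with x hx using (hz x hx).deriv
  have h1 := hz s hs.self_of_nhds
  have h2 := (h1.mul ((hss.hasDerivAt.add_const (d t * c)).const_mul (-γ))).congr_of_eventuallyEq he
  have h3 : HasDerivAt (fun x => Real.exp (-γ * (v s x + d x * (s * c))))
      (Real.exp (-γ * (v s t + d t * (s * c)))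
        * (-γ * (deriv (fun x => v s x) t + -μ * E * (s * c)))) t :=
    ((ht.hasDerivAt.add (hd.mul_const (s * c))).const_mul (-γ)).exp
  refine ⟨h2.differentiableAt, ?_⟩
  rw [h1.deriv, h2.deriv, h3.deriv, hE]
  have hy := Real.exp_pos (-γ * (v s t + E * (s * c)))
  have hm := mul_le_mul_of_nonneg_left hv (mul_nonneg hγ hy.le)
  linarith

/-- The power `s ^ (n + 2)`, with its exponential growth rate, solves the linear equation. -/
theorem deriv_power_solution (A a μ T : ℝ) (n : ℕ) (s t : ℝ) :
    (deriv fun x => A * (x ^ (n + 2)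
        * Real.exp ((a * ((n + 2) * (n + 1)) + μ * (n + 2)) * (T - t))))
      = (fun x => A * (((n + 2) * x ^ (n + 1))
        * Real.exp ((a * ((n + 2) * (n + 1)) + μ * (n + 2)) * (T - t)))) ∧
    HasDerivAt (fun x => A * (((n + 2) * x ^ (n + 1))
        * Real.exp ((a * ((n + 2) * (n + 1)) + μ * (n + 2)) * (T - t))))
      (A * (((n + 2) * ((n + 1) * s ^ n))
        * Real.exp ((a * ((n + 2) * (n + 1)) + μ * (n + 2)) * (T - t)))) s ∧
    HasDerivAt (fun x => A * (s ^ (n + 2)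
        * Real.exp ((a * ((n + 2) * (n + 1)) + μ * (n + 2)) * (T - x))))
      (-(a * ((n + 2) * (n + 1)) + μ * (n + 2)) * (A * (s ^ (n + 2)
        * Real.exp ((a * ((n + 2) * (n + 1)) + μ * (n + 2)) * (T - t))))) t := by
  refine ⟨?_, ?_, ?_⟩
  · funext x
    refine HasDerivAt.deriv ?_
    refine (((hasDerivAt_pow (n + 2) x).mul_const _).const_mul A).congr_deriv ?_
    push_cast
    rfl
  · refine ((((hasDerivAt_pow (n + 1) s).const_mul ((n : ℝ) + 2)).mul_const _).const_mul
      A).congr_deriv ?_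
    push_cast
    rfl
  · refine ((((((hasDerivAt_id t).const_sub T).const_mul _).exp).const_mul _).const_mul
      A).congr_deriv ?_
    simp
    ring

/-- In the whole region with `γ > 0` there is no solution: for a large short position in the stock
the expected disutility is infinite, whereas a solution would bound it. -/
theorem IsPenalizedSolution.false_of_pos (hγ : 0 < γ) (hδ : |δ| ≤ 1)
    (hV : IsPenalizedSolution m U kind δ (univ ×ˢ Ioi 0) V) (hR : ∀ ξ, riskAversion U ξ = γ) :
    False := by
  have hDS : IsStateRegion (univ ×ˢ Ioi (0 : ℝ)) := Or.inl rfl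
  have hθ := m.θ_nonneg
  -- For this short position the liquidation value of the stock is `-2 s`.
  set α₀ : ℝ := -2 / (1 + m.θ) with hα₀
  have hc : α₀ - m.θ * |α₀| = -2 := by
    have : α₀ ≤ 0 := div_nonpos_of_nonpos_of_nonneg (by norm_num) (by linarith)
    rw [abs_of_nonpos this, hα₀]
    field_simp
    ring
  have hmem : ∀ {s : ℝ}, 0 < s → (α₀, s) ∈ (univ ×ˢ Ioi 0 : Set (ℝ × ℝ)) := fun hs =>
    ⟨mem_univ _, hs⟩
  set v : ℝ → ℝ → ℝ := fun s t => characteristicForm m V α₀ 0 s t with hv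
  set d : ℝ → ℝ := fun t => Real.exp (m.μ * (m.T - t)) with hd
  set a := m.σ ^ 2 / 2 with ha
  have ha0 : 0 < a := by have := m.σ_pos; positivity
  set y : ℝ → ℝ → ℝ := fun s t => Real.exp (-γ * (v s t + d t * (s * -2))) with hy
  obtain ⟨n, hn⟩ := exists_lt_moment ha0 hγ m.T_pos m.μ (y 1 0 * Real.exp (γ * m.K))
  set A := Real.exp (-(γ * m.K)) * (γ ^ (n + 2) / (n + 2).factorial) with hA
  have hA0 : 0 < A := by positivity
  set κ := a * (((n : ℝ) + 2) * (n + 1)) + m.μ * (n + 2) with hκ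
  have hdv : ∀ {s t : ℝ}, 0 < s → t ∈ Ioo 0 m.T →
      DifferentiableAt ℝ (fun q : ℝ × ℝ => v q.1 q.2) (s, t) := fun {s t} hs ht =>
    (hV.differentiableAt_characteristicForm 0 (hmem hs) ht).comp
      (f := fun q : ℝ × ℝ => ((α₀, 0, q.1, q.2) : ℝ × ℝ × ℝ × ℝ)) (s, t) (by fun_prop)
  have hdvs : ∀ {s t : ℝ}, 0 < s → t ∈ Ioo 0 m.T →
      DifferentiableAt ℝ (fun x => v x t) s := fun {s t} hs ht =>
    (hdv hs ht).comp (f := fun x => ((x, t) : ℝ × ℝ)) s (by fun_prop)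
  have hdvt : ∀ {s t : ℝ}, 0 < s → t ∈ Ioo 0 m.T →
      DifferentiableAt ℝ (fun x => v s x) t := fun {s t} hs ht =>
    (hdv hs ht).comp (f := fun x => ((s, x) : ℝ × ℝ)) t (by fun_prop)
  have hsup := fun {s t : ℝ} (hs : 0 < s) (ht : t ∈ Ioo 0 m.T) =>
    exp_supersolution (a := a) (μ := m.μ) (v := v) d hγ.le (hasDerivAt_discount m t) rfl
      (by filter_upwards [Ioi_mem_nhds hs] with x hx using hdvs hx ht)
      (hV.differentiableAt_deriv_characteristicForm 0 (hmem hs) ht) (hdvt hs ht) (-2)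
      (by
        have := hV.subsolution_characteristicForm hR 0 (hmem hs) ht
        rwa [hc] at this)
  have hys : ∀ {s t : ℝ}, 0 < s → t ∈ Ioo 0 m.T →
      DifferentiableAt ℝ (fun x => y x t) s := fun hs ht => by
    have := hdvs hs ht
    simp only [hy]
    fun_prop
  have hyt : ∀ {s t : ℝ}, 0 < s → t ∈ Ioo 0 m.T →
      DifferentiableAt ℝ (fun x => y s x) t := fun hs ht => by
    have := hdvt hs ht
    simp only [hy, hd]
    fun_prop
  have hderiv : ∀ {s t : ℝ}, 0 < s → t ∈ Ioo 0 m.T →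
      (deriv fun x => A * (x ^ (n + 2) * Real.exp (κ * (m.T - t))) - y x t) =ᶠ[𝓝 s]
        fun x => A * (((n + 2) * x ^ (n + 1)) * Real.exp (κ * (m.T - t)))
          - deriv (fun x => y x t) x := by
    intro s t hs ht
    filter_upwards [Ioi_mem_nhds hs] with x hx
    rw [deriv_fun_sub (by fun_prop) (hys hx ht),
      (deriv_power_solution A a m.μ m.T n x t).1]
  have key : A * ((1 : ℝ) ^ (n + 2) * Real.exp (κ * (m.T - 0))) - y 1 0 ≤ 0 := by
    refine maximum_principle (D := univ ×ˢ Ioi (0 : ℝ))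
      (F := fun _ _ s t => A * (s ^ (n + 2) * Real.exp (κ * (m.T - t))) - y s t)
      (T := m.T) (a := a) (μ := m.μ) (M := 0) (χ := 1) (Cw := 5) (N := fun _ _ _ _ => 0)
      (C := A * Real.exp (|κ| * m.T)) (k := n + 2) (α := α₀) (b := 0)
      hDS.isOpen hDS.pos ha0.le le_rfl zero_le_one le_rfl (by norm_num)
      (fun α b s _ => size_sq_le_weight α b s) (Or.inr fun _ _ _ _ => rfl)
      ?_ ?_ ?_ ?_ ?_ ?_ ?_ (hmem one_pos) ⟨le_rfl, m.T_pos.le⟩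
    · have h1 : ContinuousOn (fun q : ℝ × ℝ × ℝ × ℝ => v q.2.2.1 q.2.2.2)
          (cylinder (univ ×ˢ Ioi 0) m.T) :=
        hV.continuousOn_characteristicForm.comp
          (f := fun q : ℝ × ℝ × ℝ × ℝ => ((α₀, 0, q.2.2.1, q.2.2.2) : ℝ × ℝ × ℝ × ℝ))
          (by fun_prop) (by
            intro q hq
            simp only [cylinder, lateral_univ_prod_Ioi, union_empty] at hq ⊢
            exact ⟨⟨mem_univ _, hq.1.2⟩, hq.2⟩)
      have h2 : ContinuousOn (fun q : ℝ × ℝ × ℝ × ℝ => d q.2.2.2 * (q.2.2.1 * -2))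
          (cylinder (univ ×ˢ Ioi 0) m.T) := by
        simp only [hd]
        fun_prop
      exact ContinuousOn.sub (by fun_prop) ((h1.add h2).const_mul (-γ)).rexp
    · intro α b s t hD ht
      have h1 : DifferentiableAt ℝ (fun q : ℝ × ℝ × ℝ × ℝ => v q.2.2.1 q.2.2.2) (α, b, s, t) :=
        (hdv hD.2 ht).comp (f := fun q : ℝ × ℝ × ℝ × ℝ => ((q.2.2.1, q.2.2.2) : ℝ × ℝ))
          (α, b, s, t) (by fun_prop)
      have h2 : DifferentiableAt ℝ (fun q : ℝ × ℝ × ℝ × ℝ => d q.2.2.2 * (q.2.2.1 * -2))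
          (α, b, s, t) := by
        simp only [hd]
        fun_prop
      exact DifferentiableAt.sub (by fun_prop) ((h1.add h2).const_mul (-γ)).exp
    · intro α b s t hD ht
      exact ((deriv_power_solution A a m.μ m.T n s t).2.1.differentiableAt.sub
        (hsup hD.2 ht).1).congr_of_eventuallyEq (hderiv hD.2 ht)
    · intro α b s hD
      have hs : 0 < s := hD.2
      have hp := abs_payoff_le m kind hs
      have hδp : δ * payoff m kind s ≤ s + m.K := by
        refine (le_abs_self _).trans ?_
        rw [abs_mul]
        exact (mul_le_of_le_one_left (abs_nonneg _) hδ).trans hp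
      have hpow := Real.pow_div_factorial_le_exp (γ * s) (by positivity) (n + 2)
      simp only [sub_self, mul_zero, Real.exp_zero, mul_one, hy, hd, hv,
        hV.characteristicForm_terminal 0 (hmem hs), one_mul]
      have h1 : Real.exp (-(γ * m.K)) * Real.exp (γ * s)
          ≤ Real.exp (-γ * (δ * payoff m kind s + s * -2)) := by
        rw [← Real.exp_add]
        refine Real.exp_le_exp.2 ?_
        nlinarith [mul_le_mul_of_nonneg_left hδp hγ.le]
      have h2 : A * s ^ (n + 2)
          = Real.exp (-(γ * m.K)) * ((γ * s) ^ (n + 2) / (n + 2).factorial) := by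
        rw [hA, mul_pow]; ring
      rw [h2, sub_nonpos]
      exact (mul_le_mul_of_nonneg_left hpow (Real.exp_pos _).le).trans h1
    · intro α b s t hl
      rw [lateral_univ_prod_Ioi] at hl
      exact absurd hl (notMem_empty _)
    · intro α b s t hD ht
      have hs : 0 < s := hD.2
      have h1 : s ≤ size α b s := by
        have := abs_nonneg α
        have := abs_nonneg b
        have : 0 < 1 / s := by positivity
        unfold size
        linarith
      have h2 : Real.exp (κ * (m.T - t)) ≤ Real.exp (|κ| * m.T) :=
        exp_le_exp_abs_mul ⟨by linarith [ht.2], by linarith [ht.1]⟩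
      have h3 : 0 < y s t := Real.exp_pos _
      have h4 := one_le_size (α := α) (b := b) hs
      calc A * (s ^ (n + 2) * Real.exp (κ * (m.T - t))) - y s t
          ≤ A * (s ^ (n + 2) * Real.exp (κ * (m.T - t))) := by linarith
        _ ≤ A * (size α b s ^ (n + 2) * Real.exp (|κ| * m.T)) := by gcongr
        _ = _ := by ring
    · intro α b s t hD ht
      have hs : 0 < s := hD.2
      have hp := deriv_power_solution A a m.μ m.T n s t
      have c1 := (hderiv hs ht).self_of_nhds
      have c2 := (hderiv hs ht).deriv_eq
      rw [deriv_fun_sub hp.2.1.differentiableAt (hsup hs ht).1, hp.2.1.deriv] at c2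
      have c3 : deriv (fun x => A * (s ^ (n + 2) * Real.exp (κ * (m.T - x))) - y s x) t
          = -κ * (A * (s ^ (n + 2) * Real.exp (κ * (m.T - t)))) - deriv (fun x => y s x) t := by
        rw [deriv_fun_sub hp.2.2.differentiableAt (hyt hs ht), hp.2.2.deriv]
      have hle := (hsup hs ht).2
      rw [c1, c2, c3]
      simp only [zero_mul, add_zero]
      rw [← hκ]
      have hid : a * s ^ 2 * (A * ((n + 2) * ((n + 1) * s ^ n) * Real.exp (κ * (m.T - t))))
          + m.μ * s * (A * ((n + 2) * s ^ (n + 1) * Real.exp (κ * (m.T - t))))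
          = κ * (A * (s ^ (n + 2) * Real.exp (κ * (m.T - t)))) := by
        rw [hκ]; ring
      linarith
  rw [one_pow, one_mul, sub_zero] at key
  have hKexp : Real.exp (-(γ * m.K)) * Real.exp (γ * m.K) = 1 := by
    rw [← Real.exp_add]; simp
  have h1 := mul_le_mul_of_nonneg_right (sub_nonpos.1 key) (Real.exp_pos (γ * m.K)).le
  have h2 : A * Real.exp (κ * m.T) * Real.exp (γ * m.K)
      = γ ^ (n + 2) / (n + 2).factorial * Real.exp (κ * m.T) := by
    rw [hA]
    linear_combination (γ ^ (n + 2) / (n + 2).factorial * Real.exp (κ * m.T)) * hKexp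
  linarith

/-! ### Independence of `β`, the Black–Scholes bound and the price -/

/-- Solutions do not depend on the bank account. -/
theorem IsPenalizedSolution.eq_of_beta (hDS : IsStateRegion D) (hδ : |δ| ≤ 1)
    (hV : IsPenalizedSolution m U kind δ D V) (hγ : 0 ≤ γ) (hR : ∀ ξ, riskAversion U ξ = γ)
    (hlat : ∀ α s, (α, s) ∈ lateral D → ∀ β β', ∀ t ∈ Icc 0 m.T, V α β s t = V α β' s t)
    {α s t : ℝ} (β β' : ℝ) (hD : (α, s) ∈ D) (ht : t ∈ Icc 0 m.T) :
    V α β s t = V α β' s t := by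
  have hcase : γ = 0 ∨ (Bornology.IsBounded D ∧ closure D ⊆ univ ×ˢ Ioi 0) := by
    rcases hγ.eq_or_lt with h | h
    · exact Or.inl h.symm
    · rcases hDS with rfl | h2
      · exact (hV.false_of_pos h hδ hR).elim
      · exact Or.inr h2.2
  have key : ∀ β β', V α β s t ≤ V α β' s t := by
    intro β β'
    have h := hV.characteristicForm_le_translate hDS hγ hR hcase hlat
      (β * Real.exp (-(m.r * t))) (β' * Real.exp (-(m.r * t)) - β * Real.exp (-(m.r * t))) hD ht
    have hexp : Real.exp (-(m.r * t)) * Real.exp (m.r * t) = 1 := by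
      rw [← Real.exp_add]; simp
    rw [add_sub_cancel] at h
    simp only [characteristicForm, mul_assoc, hexp, mul_one] at h
    exact le_of_mul_le_mul_left h (Real.exp_pos _)
  exact le_antisymm (key β β') (key β' β)

/-- Since the penalties and the risk term have a sign, a solution restricted to `β = 0` is a
subsolution of the Black–Scholes equation. -/
theorem IsPenalizedSolution.le_blackScholes (hDS : IsStateRegion D)
    (hV : IsPenalizedSolution m U kind δ D V) (hγ : 0 ≤ γ) (hR : ∀ ξ, riskAversion U ξ = γ)
    {u : ℝ → ℝ → ℝ} (hu : IsBlackScholesSolution m kind δ u)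
    (hlat : ∀ α s, (α, s) ∈ lateral D → ∀ t ∈ Icc 0 m.T, V α 0 s t ≤ u s t)
    {α s t : ℝ} (hD : (α, s) ∈ D) (ht : t ∈ Icc 0 m.T) : V α 0 s t ≤ u s t := by
  set d : ℝ → ℝ := fun t => Real.exp (m.μ * (m.T - t)) with hd
  set v := characteristicForm m V with hv
  have hv0 : ∀ α s t, v α 0 s t = d t * V α 0 s t := fun α s t => by
    simp [hv, characteristicForm, hd]
  suffices hF : v α 0 s t - d t * u s t ≤ 0 by
    rw [hv0, sub_nonpos] at hF
    exact le_of_mul_le_mul_left hF (Real.exp_pos _)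
  obtain ⟨C₁, k₁, hC₁, hg₁⟩ := hV.growth_characteristicForm hDS.pos
  obtain ⟨C₂, k₂, hg₂⟩ := hu.growth
  have hus : ∀ {s t : ℝ}, 0 < s → t ∈ Ioo 0 m.T →
      DifferentiableAt ℝ (fun x => u x t) s := fun {s t} hs ht =>
    (hu.differentiableAt s t hs ht).comp (f := fun x => ((x, t) : ℝ × ℝ)) s (by fun_prop)
  have hut : ∀ {s t : ℝ}, 0 < s → t ∈ Ioo 0 m.T →
      DifferentiableAt ℝ (fun x => u s x) t := fun {s t} hs ht =>
    (hu.differentiableAt s t hs ht).comp (f := fun x => ((s, x) : ℝ × ℝ)) t (by fun_prop)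
  have ds : ∀ {α s t : ℝ}, (α, s) ∈ D → t ∈ Ioo 0 m.T →
      DifferentiableAt ℝ (fun x => v α 0 x t) s := fun {α s t} hD ht =>
    (hV.differentiableAt_characteristicForm 0 hD ht).comp
      (f := fun x => ((α, 0, x, t) : ℝ × ℝ × ℝ × ℝ)) s (by fun_prop)
  have dt : ∀ {α s t : ℝ}, (α, s) ∈ D → t ∈ Ioo 0 m.T →
      DifferentiableAt ℝ (fun x => v α 0 s x) t := fun {α s t} hD ht =>
    (hV.differentiableAt_characteristicForm 0 hD ht).comp
      (f := fun x => ((α, 0, s, x) : ℝ × ℝ × ℝ × ℝ)) t (by fun_prop)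
  have hderiv : ∀ {α s t : ℝ}, (α, s) ∈ D → t ∈ Ioo 0 m.T →
      (deriv fun x => v α 0 x t - d t * u x t) =ᶠ[𝓝 s]
        fun y => deriv (fun x => v α 0 x t) y - d t * deriv (fun x => u x t) y := by
    intro α s t hD ht
    have hDs : ∀ᶠ x in 𝓝 s, (α, x) ∈ D :=
      (Continuous.continuousAt (by fun_prop : Continuous fun x : ℝ => (α, x))).eventually
        (hDS.isOpen.mem_nhds hD)
    filter_upwards [hDs] with y hy
    rw [deriv_fun_sub (ds hy ht) ((hus (hDS.pos _ hy) ht).const_mul _), deriv_const_mul_field]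
  refine maximum_principle (F := fun α _ s t => v α 0 s t - d t * u s t)
    (T := m.T) (a := m.σ ^ 2 / 2) (μ := m.μ) (M := 0) (χ := 1) (Cw := 5) (N := fun _ _ _ _ => 0)
    (C := C₁ + Real.exp (|m.μ| * m.T) * |C₂|) (k := k₁ + k₂) (b := 0)
    hDS.isOpen hDS.pos (by positivity) le_rfl zero_le_one le_rfl (by norm_num)
    (fun α b s _ => size_sq_le_weight α b s) (Or.inr fun _ _ _ _ => rfl)
    ?_ ?_ ?_ ?_ ?_ ?_ ?_ hD ht
  · have h1 : ContinuousOn (fun q : ℝ × ℝ × ℝ × ℝ => v q.1 0 q.2.2.1 q.2.2.2)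
        (cylinder D m.T) :=
      hV.continuousOn_characteristicForm.comp
        (f := fun q : ℝ × ℝ × ℝ × ℝ => ((q.1, 0, q.2.2.1, q.2.2.2) : ℝ × ℝ × ℝ × ℝ))
        (by fun_prop) fun q hq => hq
    have h2 : ContinuousOn (fun q : ℝ × ℝ × ℝ × ℝ => u q.2.2.1 q.2.2.2) (cylinder D m.T) :=
      hu.continuousOn.comp (f := fun q : ℝ × ℝ × ℝ × ℝ => ((q.2.2.1, q.2.2.2) : ℝ × ℝ))
        (by fun_prop) fun q hq => ⟨hq.1.elim (fun h => hDS.pos _ h) fun h => h.2.2, hq.2⟩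
    have h3 : ContinuousOn (fun q : ℝ × ℝ × ℝ × ℝ => d q.2.2.2) (cylinder D m.T) := by
      simp only [hd]
      fun_prop
    exact h1.sub (h3.mul h2)
  · intro α b s t hD ht
    have h1 : DifferentiableAt ℝ (fun q : ℝ × ℝ × ℝ × ℝ => v q.1 0 q.2.2.1 q.2.2.2) (α, b, s, t) :=
      (hV.differentiableAt_characteristicForm 0 hD ht).comp
        (f := fun q : ℝ × ℝ × ℝ × ℝ => ((q.1, 0, q.2.2.1, q.2.2.2) : ℝ × ℝ × ℝ × ℝ))
        (α, b, s, t) (by fun_prop)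
    have h2 : DifferentiableAt ℝ (fun q : ℝ × ℝ × ℝ × ℝ => u q.2.2.1 q.2.2.2) (α, b, s, t) :=
      (hu.differentiableAt s t (hDS.pos _ hD) ht).comp
        (f := fun q : ℝ × ℝ × ℝ × ℝ => ((q.2.2.1, q.2.2.2) : ℝ × ℝ))
        (α, b, s, t) (by fun_prop)
    have h3 : DifferentiableAt ℝ (fun q : ℝ × ℝ × ℝ × ℝ => d q.2.2.2) (α, b, s, t) := by
      simp only [hd]
      fun_prop
    exact h1.sub (h3.mul h2)
  · intro α b s t hD ht
    exact ((hV.differentiableAt_deriv_characteristicForm 0 hD ht).sub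
      ((hu.differentiableAt_deriv s t (hDS.pos _ hD) ht).const_mul (d t))).congr_of_eventuallyEq
        (hderiv hD ht)
  · intro α b s hD
    simp only [hv, hV.characteristicForm_terminal _ hD, hd, hu.terminal s (hDS.pos _ hD), sub_self,
      mul_zero, Real.exp_zero, one_mul, le_refl]
  · intro α b s t hl ht
    rw [hv0, sub_nonpos]
    exact mul_le_mul_of_nonneg_left (hlat α s hl t ht) (Real.exp_pos _).le
  · intro α b s t hD ht
    have hs : 0 < s := hDS.pos _ hD
    have hi : 0 < 1 / s := by positivity
    have hb := abs_nonneg b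
    have hα := abs_nonneg α
    have h1 := one_le_size (α := α) (b := b) hs
    have e1 : |v α 0 s t| ≤ C₁ * size α b s ^ (k₁ + k₂) := by
      have := hg₁ 0 α 0 s t hD ht
      simp only [add_zero, abs_zero, one_pow, mul_one] at this
      refine this.trans (mul_le_mul_of_nonneg_left ?_ hC₁)
      have h2 : size α 0 s ≤ size α b s := by
        unfold size
        rw [abs_zero]
        linarith
      have h3 := one_le_size (α := α) (b := 0) hs
      calc size α 0 s ^ k₁ ≤ size α b s ^ k₁ := by gcongr
        _ ≤ _ := pow_le_pow_right₀ h1 (Nat.le_add_right _ _)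
    have e2 : |u s t| ≤ |C₂| * size α b s ^ (k₁ + k₂) := by
      calc |u s t| ≤ C₂ * (1 + s + 1 / s) ^ k₂ := hg₂ s t hs ht
        _ ≤ |C₂| * (1 + s + 1 / s) ^ k₂ := by
            gcongr
            exact le_abs_self _
        _ ≤ |C₂| * size α b s ^ k₂ := by
            gcongr
            unfold size
            linarith
        _ ≤ _ := by
            gcongr
            exact Nat.le_add_left _ _
    have e3 : d t * |u s t| ≤ Real.exp (|m.μ| * m.T) * (|C₂| * size α b s ^ (k₁ + k₂)) :=
      mul_le_mul (discount_le ht) e2 (abs_nonneg _) (Real.exp_pos _).le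
    have e4 : -(d t * u s t) ≤ d t * |u s t| := by
      have := mul_le_mul_of_nonneg_left (neg_abs_le (u s t)) (Real.exp_pos _ : 0 < d t).le
      linarith
    have e5 := le_abs_self (v α 0 s t)
    linarith
  · intro α b s t hD ht
    have hs : 0 < s := hDS.pos _ hD
    have c1 : deriv (fun x => v α 0 x t - d t * u x t) s
        = deriv (fun x => v α 0 x t) s - d t * deriv (fun x => u x t) s :=
      (hderiv hD ht).self_of_nhds
    have c2 : deriv (deriv fun x => v α 0 x t - d t * u x t) s
        = deriv (deriv fun x => v α 0 x t) s - d t * deriv (deriv fun x => u x t) s := by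
      rw [(hderiv hD ht).deriv_eq, deriv_fun_sub
        (hV.differentiableAt_deriv_characteristicForm 0 hD ht)
        ((hu.differentiableAt_deriv s t hs ht).const_mul _), deriv_const_mul_field]
    have hdu := (hasDerivAt_discount m t).mul (hut hs ht).hasDerivAt
    have c3 : deriv (fun x => v α 0 s x - d x * u s x) t
        = deriv (fun x => v α 0 s x) t
          - (-m.μ * d t * u s t + d t * deriv (fun x => u s x) t) :=
      ((dt hD ht).hasDerivAt.sub hdu).deriv
    have hsub := hV.subsolution_characteristicForm hR 0 hD ht
    have h0 : 0 ≤ m.σ ^ 2 / 2 * γ * (Real.exp (m.μ * (m.T - t)) * (s * (α - m.θ * |α|))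
          + s * deriv (fun x => characteristicForm m V α 0 x t) s) ^ 2 := by positivity
    have hue := hu.equation s t hs ht
    rw [c1, c2, c3]
    have hsub' := h0.trans hsub
    rw [← hv] at hsub'
    have hid : d t * (deriv (fun x => u s x) t
      + m.σ ^ 2 / 2 * s ^ 2 * deriv (deriv fun x => u x t) s
      + m.μ * s * deriv (fun x => u x t) s - m.μ * u s t) = 0 := by rw [hue, mul_zero]
    linarith

theorem IsUtility.injective (hU : IsUtility U) : Function.Injective U :=
  (strictMono_of_deriv_pos hU.2).injective

/-- The price only involves the difference of the two solutions. -/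
theorem optionPrice_eq (hU : IsUtility U) (V₀ V : ℝ → ℝ → ℝ → ℝ → ℝ) (α β s t : ℝ) :
    optionPrice m U V₀ V α β s t = Real.exp (-m.r * (m.T - t))
      * (Real.exp (m.μ * (m.T - t)) * (V₀ α β s t - V α β s t)) := by
  simp only [optionPrice, certaintyEquivalent, valueFunction,
    Function.leftInverse_invFun hU.injective _, utilityArg]
  ring

end UtilityIndifference

theorem proposition1 (m : UtilityIndifference.Market) (kind : UtilityIndifference.OptionKind)
    (δ : ℝ) (hδ : δ = 0 ∨ δ = 1 ∨ δ = -1)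
    (γ : ℝ) (hγ : 0 ≤ γ)
    (U : ℝ → ℝ) (hU : UtilityIndifference.IsUtility U)
    (hR : ∀ ξ, UtilityIndifference.riskAversion U ξ = γ)
    (D : Set (ℝ × ℝ)) (hD : UtilityIndifference.IsStateRegion D)
    (V : ℝ → ℝ → ℝ → ℝ → ℝ)
    (hV : UtilityIndifference.IsPenalizedSolution m U kind δ D V)
    -- the lateral conditions, here and below, are void when `D` is the whole `ℝ × (0, ∞)`
    (hlat : ∀ α s, (α, s) ∈ UtilityIndifference.lateral D → ∀ β β', ∀ t ∈ Set.Icc 0 m.T,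
      V α β s t = V α β' s t) :
    ∃ W : ℝ → ℝ → ℝ → ℝ,
      (∀ α β s t, (α, s) ∈ D → t ∈ Set.Icc 0 m.T → V α β s t = W α s t) ∧
      (∀ V₀ : ℝ → ℝ → ℝ → ℝ → ℝ, UtilityIndifference.IsPenalizedSolution m U kind 0 D V₀ →
        (∀ α s, (α, s) ∈ UtilityIndifference.lateral D → ∀ β β', ∀ t ∈ Set.Icc 0 m.T,
          V₀ α β s t = V₀ α β' s t) →
        ∃ P : ℝ → ℝ → ℝ → ℝ, ∀ α β s t, (α, s) ∈ D → t ∈ Set.Icc 0 m.T →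
          UtilityIndifference.optionPrice m U V₀ V α β s t = P α s t) ∧
      (∀ VBS : ℝ → ℝ → ℝ, UtilityIndifference.IsBlackScholesSolution m kind δ VBS →
        (∀ α s, (α, s) ∈ UtilityIndifference.lateral D → ∀ β, ∀ t ∈ Set.Icc 0 m.T,
          V α β s t ≤ VBS s t) →
        ∀ α s t, (α, s) ∈ D → t ∈ Set.Icc 0 m.T → W α s t ≤ VBS s t) := by
  have hδ' : |δ| ≤ 1 := by
    rcases hδ with rfl | rfl | rfl <;> simp
  refine ⟨fun α s t => V α 0 s t, fun α β s t hs ht => hV.eq_of_beta hD hδ' hγ hR hlat β 0 hs ht,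
    fun V₀ hV₀ hlat₀ => ⟨fun α s t => UtilityIndifference.optionPrice m U V₀ V α 0 s t,
      fun α β s t hs ht => ?_⟩,
    fun VBS hu hle α s t hs ht =>
      hV.le_blackScholes hD hγ hR hu (fun α s hl t ht => hle α s hl 0 t ht) hs ht⟩
  simp only [UtilityIndifference.optionPrice_eq hU]
  rw [hV.eq_of_beta hD hδ' hγ hR hlat β 0 hs ht,
    hV₀.eq_of_beta hD (by simp) hγ hR hlat₀ β 0 hs ht]
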